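/- Let $A$ be a locally compact (Hausdorff) abelian group, written multiplicatively, with a fixed Haar measure $dx$, and let $\widehat A$ be its Pontryagin dual, equipped with the Haar measure $d\xi$ dual to $dx$ (the Haar measure on $\widehat A$ for which Plancherel's formula $\int_{\widehat A}|\hat f|^2\,d\xi=\int_A|f|^2\,dx$, $\hat f(\xi)=\int_A\overline{\xi(x)}f(x)\,dx$, holds for all continuous compactly supported $f$). A family of functions $\phi_i\colon A^2\to\mathbb C$, $i\in\{0,1,2,3,4\}$, is said to be of the *beta pentagon type* over $A$ if for all $x,y,u,v\in A$ the integral below converges absolutely and $$\phi_1(x,y)\,\phi_3(u,v)=\int_A \phi_4(uy,vz^{-1})\,\phi_2(xyuvz^{-1},z)\,\phi_0(xv,yz^{-1})\,dz .$$ The same definition applies to $\widehat A$ with the measure $d\xi$. Let $(\phi_i)_{0\le i\le 4}$ be of the beta pentagon type over $A$. Assume that every $\phi_i$ is integrable on $A^2$, and that the partial Fourier transform $$\check\phi_2(\xi,y)=\int_A\overline{\xi(x)}\,\phi_2(x,y)\,dx,\qquad (\xi,y)\in\widehat A\times A,$$ is integrable on $\widehat A\times A$. Then the Fourier transforms $$\hat\phi_i(\xi,\eta)=\int_{A^2}\frac{\xi(y)}{\eta(x)}\,\phi_i(x,y)\,dx\,dy,\qquad(\xi,\eta)\in\widehat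 A^2,\quad i\in\{0,1,2,3,4\},$$ are of the beta pentagon type over $\widehat A$: for all $\xi,\eta,\mu,\nu\in\widehat A$ the integral below converges absolutely and $$\hat\phi_1(\xi,\eta)\,\hat\phi_3(\mu,\nu)=\int_{\widehat A}\hat\phi_4(\mu\eta,\nu\sigma^{-1})\,\hat\phi_2(\xi\eta\mu\nu\sigma^{-1},\sigma)\,\hat\phi_0(\xi\nu,\eta\sigma^{-1})\,d\sigma .$$ -/

import Mathlib

open MeasureTheory CompactlySupported

noncomputable section

/-! ### Integration over a product of two locally compact spaces

For a group that is not second countable, the Borel sigma-algebra of `X × Y` can be larger than the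
product of the Borel sigma-algebras, and Haar measure need not be sigma-finite, so that
`Measure.prod` is not the right object.  The Radon product below is the textbook one, and it
lives on the Borel sigma-algebra of the product topology. -/

section RadonProduct

set_option linter.unusedSectionVars false

variable {X Y : Type*} [TopologicalSpace X] [T2Space X] [LocallyCompactSpace X]
  [MeasurableSpace X] [BorelSpace X] [TopologicalSpace Y] [T2Space Y] [LocallyCompactSpace Y]
  [MeasurableSpace Y] [BorelSpace Y]

theorem hasCompactSupport_slice (f : C_c(X × Y, ℝ)) (x : X) :
    HasCompactSupport (fun y => f (x, y)) := by
  refine HasCompactSupport.intro (f.hasCompactSupport.isCompact.image continuous_snd) ?_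
  intro y hy
  by_contra h
  exact hy ⟨(x, y), subset_tsupport _ h, rfl⟩

theorem integrable_slice (ν : Measure Y) [IsFiniteMeasureOnCompacts ν]
    (f : C_c(X × Y, ℝ)) (x : X) : Integrable (fun y => f (x, y)) ν :=
  (f.continuous.comp (by fun_prop : Continuous fun y : Y => (x, y))).integrable_of_hasCompactSupport
    (hasCompactSupport_slice f x)

theorem integrable_integral_slice (μ : Measure X) [IsFiniteMeasureOnCompacts μ]
    (ν : Measure Y) [IsFiniteMeasureOnCompacts ν] (f : C_c(X × Y, ℝ)) :
    Integrable (fun x => ∫ y, f (x, y) ∂ν) μ := by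
  have hK := f.hasCompactSupport.isCompact.image (continuous_snd (X := X) (Y := Y))
  have hL := f.hasCompactSupport.isCompact.image (continuous_fst (X := X) (Y := Y))
  have hc : Continuous fun x => ∫ y, f (x, y) ∂ν := by
    refine continuousOn_univ.mp
      (continuousOn_integral_of_compact_support (μ := ν) hK (s := Set.univ) ?_ ?_)
    · exact f.continuous.continuousOn
    · intro x y _ hy
      by_contra h
      exact hy ⟨(x, y), subset_tsupport _ h, rfl⟩
  refine hc.integrable_of_hasCompactSupport (HasCompactSupport.intro hL ?_)
  intro x hx
  have : ∀ y, f (x, y) = 0 := by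
    intro y
    by_contra h
    exact hx ⟨(x, y), subset_tsupport _ h, rfl⟩
  simp [this]

/-- The positive linear functional `f ↦ ∫ (∫ f(x, y) dν(y)) dμ(x)` on `C_c(X × Y)`. -/
def iteratedIntegral (μ : Measure X) [IsFiniteMeasureOnCompacts μ]
    (ν : Measure Y) [IsFiniteMeasureOnCompacts ν] : C_c(X × Y, ℝ) →ₚ[ℝ] ℝ :=
  PositiveLinearMap.mk₀
    { toFun := fun f => ∫ x, ∫ y, f (x, y) ∂ν ∂μ
      map_add' := by
        intro f g
        have h : ∀ x, ∫ y, (f + g) (x, y) ∂ν = ∫ y, f (x, y) ∂ν + ∫ y, g (x, y) ∂ν := fun x => by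
          simpa using integral_add (integrable_slice ν f x) (integrable_slice ν g x)
        simp only [h]
        exact integral_add (integrable_integral_slice μ ν f) (integrable_integral_slice μ ν g)
      map_smul' := by
        intro c f
        simp [integral_const_mul] }
    (by
      intro f hf
      exact integral_nonneg fun x => integral_nonneg fun y => hf (x, y))

/-- The Radon product of `μ` and `ν`: the regular Borel measure on `X × Y` with
`∫ f = ∫∫ f(x, y) dν(y) dμ(x)` for all compactly supported continuous `f`. -/
def radonProd (μ : Measure X) [IsFiniteMeasureOnCompacts μ]
    (ν : Measure Y) [IsFiniteMeasureOnCompacts ν] : @Measure (X × Y) (borel (X × Y)) :=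
  @RealRMK.rieszMeasure (X × Y) _ _ (borel (X × Y)) (@BorelSpace.mk _ _ (borel (X × Y)) rfl)
    (iteratedIntegral μ ν) _

end RadonProduct

/-! ### The beta pentagon relation -/

/-- `φ : [4] × G² → ℂ` is of the beta pentagon type over the group `G` with the measure `μ`:
for all `x, y, u, v`, the function of `z` on the right is integrable, and the
five term integral relation holds. -/
def IsBetaPentagonType {G : Type*} [CommGroup G] [MeasurableSpace G] (μ : Measure G)
    (φ : Fin 5 → G × G → ℂ) : Prop :=
  ∀ x y u v : G,
    Integrable (fun z =>
      φ 4 (u * y, v * z⁻¹) * φ 2 (x * y * u * v * z⁻¹, z) * φ 0 (x * v, y * z⁻¹)) μ ∧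
    φ 1 (x, y) * φ 3 (u, v) =
      ∫ z, φ 4 (u * y, v * z⁻¹) * φ 2 (x * y * u * v * z⁻¹, z) * φ 0 (x * v, y * z⁻¹) ∂μ

/-! ### Fourier transforms -/

section Fourier

variable {A : Type*} [CommGroup A] [TopologicalSpace A] [MeasurableSpace A]

/-- `f̂(ξ) = ∫ conj(ξ(x)) f(x) dx` on the group `A`. -/
def fourierDual (μ : Measure A) (f : A → ℂ) (ξ : PontryaginDual A) : ℂ :=
  ∫ x, ((ξ x)⁻¹ : Circle) * f x ∂μ

/-- The partial Fourier transform `(ξ, y) ↦ ∫ conj(ξ(x)) f(x, y) dx`. -/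
def partialFourier (μ : Measure A) (f : A × A → ℂ) (p : PontryaginDual A × A) : ℂ :=
  fourierDual μ (fun x => f (x, p.2)) p.1

/-- The Fourier transform `(ξ, η) ↦ ∫_{A²} ξ(y) / η(x) f(x, y) dx dy`. -/
def betaFourier [T2Space A] [LocallyCompactSpace A] [BorelSpace A]
    (μ : Measure A) [IsFiniteMeasureOnCompacts μ] (f : A × A → ℂ)
    (q : PontryaginDual A × PontryaginDual A) : ℂ :=
  ∫ p, ((q.1 p.2 / q.2 p.1 : Circle) : ℂ) * f p ∂(radonProd μ μ)

/-- The Haar measure `ν` on the Pontryagin dual is dual to the Haar measure `μ` on `A`: it is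
normalized so that Plancherel's formula `∫ |f̂|² dν = ∫ |f|² dμ` holds for compactly supported
continuous functions. -/
def IsDualHaarMeasure [IsTopologicalGroup A] (μ : Measure A) [μ.IsHaarMeasure] [μ.Regular]
    [MeasurableSpace (PontryaginDual A)] (ν : Measure (PontryaginDual A)) [ν.IsHaarMeasure]
    [ν.Regular] : Prop :=
  ∀ f : A → ℂ, Continuous f → HasCompactSupport f →
    ∫⁻ ξ, ‖fourierDual μ f ξ‖ₑ ^ 2 ∂ν = ∫⁻ x, ‖f x‖ₑ ^ 2 ∂μ

end Fourier

end

/-! In the dual right-hand side, write φ̂₄ and φ̂₀ as integrals over A², and φ̂₂ as the integral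
over z of a character times φ̌₂(σ, z). Since φ₄, φ₀ and φ̌₂ are integrable, the result is one
absolutely convergent integral over (A² × A²) × (Â × A); integrating back in this order is
`integral_pentagonIntegrand_eq_dual`.

The same integral is evaluated differently after the measure-preserving substitution (x, y, u, v) ↦
(uy, v/z, xv, y/z), in `integral_pentagonIntegrand_eq_integral`. By `betaKernel_mul_betaKernel` the
characters recombine so that σ survives only in σ(xyuv/z). The σ-integral is then Fourier inversion
of φ₂ at (xyuv/z, z), the z-integral is the given pentagon relation, and the remaining integral over
x, y, u, v splits into φ̂₁ φ̂₃.

Haar measure need not be σ-finite, so the analysis rests on approximation by C_c functions. This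
gives Fubini for integrable functions (`MeasureTheory.Integrable.radonProd_fubini`) and
integrability of tensor products (`MeasureTheory.Integrable.mul_radonProd`). Fourier inversion is
derived from Plancherel, almost everywhere on each compact set (`eq_fourierInv_ae_of_isCompact`).
That suffices because the factor φ₀ vanishes almost everywhere off a countable union of compact
sets. -/

section BorelProduct

open Filter Topology Set
open scoped ENNReal NNReal

set_option linter.unusedSectionVars false

/-- The Borel sigma-algebra of the product topology. -/
abbrev borelProd (X Y : Type*) [TopologicalSpace X] [TopologicalSpace Y] :
    MeasurableSpace (X × Y) := borel (X × Y)

attribute [local instance] borelProd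

theorem borelSpace_borelProd (X Y : Type*) [TopologicalSpace X] [TopologicalSpace Y] :
    BorelSpace (X × Y) := ⟨rfl⟩

attribute [local instance] borelSpace_borelProd

/-! ### Slices of open sets and of null sets for the Radon product. -/

section Slicing

variable {X Y : Type*} [TopologicalSpace X] [T2Space X] [LocallyCompactSpace X]
  [MeasurableSpace X] [BorelSpace X] [TopologicalSpace Y] [T2Space Y] [LocallyCompactSpace Y]
  [MeasurableSpace Y] [BorelSpace Y]

instance regular_radonProd (μ : Measure X) [IsFiniteMeasureOnCompacts μ]
    (ν : Measure Y) [IsFiniteMeasureOnCompacts ν] : (radonProd μ ν).Regular :=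
  RealRMK.regular_rieszMeasure (iteratedIntegral μ ν)

theorem hasCompactSupport_slice_right {E : Type*} [Zero E] {f : X × Y → E}
    (hf : HasCompactSupport f) (x : X) : HasCompactSupport (fun y => f (x, y)) := by
  refine HasCompactSupport.intro (hf.isCompact.image continuous_snd) fun y hy => ?_
  by_contra h
  exact hy ⟨(x, y), subset_tsupport _ h, rfl⟩

theorem eq_zero_of_notMem_image_fst {E : Type*} [Zero E] {f : X × Y → E} {x : X}
    (hx : x ∉ Prod.fst '' tsupport f) (y : Y) : f (x, y) = 0 := by
  by_contra h
  exact hx ⟨(x, y), subset_tsupport _ h, rfl⟩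

section Slices

variable {E : Type*} [NormedAddCommGroup E] [NormedSpace ℝ E]

theorem continuous_integral_slice (ν : Measure Y) [IsFiniteMeasureOnCompacts ν] {f : X × Y → E}
    (hf : Continuous f) (hf' : HasCompactSupport f) : Continuous fun x => ∫ y, f (x, y) ∂ν := by
  refine continuousOn_univ.mp (continuousOn_integral_of_compact_support (μ := ν)
    (hf'.isCompact.image continuous_snd) (s := Set.univ) hf.continuousOn ?_)
  intro x y _ hy
  by_contra h
  exact hy ⟨(x, y), subset_tsupport _ h, rfl⟩

theorem hasCompactSupport_integral_slice (ν : Measure Y) {f : X × Y → E}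
    (hf' : HasCompactSupport f) : HasCompactSupport fun x => ∫ y, f (x, y) ∂ν := by
  refine HasCompactSupport.intro (hf'.isCompact.image continuous_fst) fun x hx => ?_
  simp [eq_zero_of_notMem_image_fst hx]

end Slices

variable (μ : Measure X) [μ.Regular] (ν : Measure Y) [ν.Regular]

theorem integral_radonProd_compactlySupported (f : C_c(X × Y, ℝ)) :
    ∫ p, f p ∂(radonProd μ ν) = ∫ x, ∫ y, f (x, y) ∂ν ∂μ :=
  RealRMK.integral_rieszMeasure (iteratedIntegral μ ν) f

theorem lintegral_radonProd_of_hasCompactSupport {f : X × Y → ℝ} (hf : Continuous f)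
    (hf' : HasCompactSupport f) (h0 : ∀ p, 0 ≤ f p) :
    ∫⁻ p, ENNReal.ofReal (f p) ∂(radonProd μ ν) =
      ∫⁻ x, ∫⁻ y, ENNReal.ofReal (f (x, y)) ∂ν ∂μ := by
  have hc := continuous_integral_slice ν hf hf'
  have hs : ∀ x, Integrable (fun y => f (x, y)) ν := fun x =>
    Continuous.integrable_of_hasCompactSupport (by fun_prop) (hasCompactSupport_slice_right hf' x)
  rw [← ofReal_integral_eq_lintegral_ofReal (hf.integrable_of_hasCompactSupport hf')
    (ae_of_all _ h0), show ∫ p, f p ∂(radonProd μ ν) = ∫ x, ∫ y, f (x, y) ∂ν ∂μ from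
      integral_radonProd_compactlySupported μ ν ⟨⟨f, hf⟩, hf'⟩,
    ofReal_integral_eq_lintegral_ofReal (hc.integrable_of_hasCompactSupport
    (hasCompactSupport_integral_slice ν hf')) (ae_of_all _ fun x => integral_nonneg fun y => h0 _)]
  exact lintegral_congr fun x =>
    ofReal_integral_eq_lintegral_ofReal (hs x) (ae_of_all _ fun y => h0 _)

theorem integral_radonProd_of_hasCompactSupport {f : X × Y → ℂ} (hf : Continuous f)
    (hf' : HasCompactSupport f) :
    ∫ p, f p ∂(radonProd μ ν) = ∫ x, ∫ y, f (x, y) ∂ν ∂μ := by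
  have hc := continuous_integral_slice ν hf hf'
  have hs : ∀ x, Integrable (fun y => f (x, y)) ν := fun x =>
    Continuous.integrable_of_hasCompactSupport (by fun_prop) (hasCompactSupport_slice_right hf' x)
  have key : ∀ l : ℂ →L[ℝ] ℝ, l (∫ p, f p ∂(radonProd μ ν)) = l (∫ x, ∫ y, f (x, y) ∂ν ∂μ) := by
    intro l
    rw [← l.integral_comp_comm (hf.integrable_of_hasCompactSupport hf'),
      ← l.integral_comp_comm (hc.integrable_of_hasCompactSupport
        (hasCompactSupport_integral_slice ν hf'))]
    have := integral_radonProd_compactlySupported μ ν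
      ⟨⟨fun p => l (f p), by fun_prop⟩, hf'.comp_left (g := l) (map_zero l)⟩
    refine this.trans (integral_congr_ae (ae_of_all _ fun x => ?_))
    exact l.integral_comp_comm (hs x)
  exact Complex.ext (key Complex.reCLM) (key Complex.imCLM)

/-- Take a Urysohn function equal to 1 on {x} × K, where K is a compact part of the slice of measure
above c. Its slice integrals depend continuously on x, unlike the slice measures of `U`. -/
theorem exists_lt_lintegral_of_lt_measure_slice {U : Set (X × Y)} (hU : IsOpen U)
    {c : ℝ≥0∞} {x : X} (hx : c < ν {y | (x, y) ∈ U}) :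
    ∃ f : X × Y → ℝ, Continuous f ∧ HasCompactSupport f ∧ (∀ p, f p ∈ Icc (0 : ℝ) 1) ∧
      (∀ p ∉ U, f p = 0) ∧ c < ∫⁻ y, ENNReal.ofReal (f (x, y)) ∂ν := by
  have hUx : IsOpen {y | (x, y) ∈ U} := hU.preimage (by fun_prop : Continuous fun y : Y => (x, y))
  obtain ⟨K, hKU, hK, hcK⟩ := hUx.exists_lt_isCompact hx
  obtain ⟨f, hf1, hfc, hfU, hf01⟩ := exists_continuousMap_one_of_isCompact_subset_isOpen
    ((isCompact_singleton (x := x)).prod hK) hU (by rintro ⟨a, b⟩ ⟨rfl, hb⟩; exact hKU hb)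
  refine ⟨f, f.continuous, hfc, hf01, fun p hp => ?_, hcK.trans_le ?_⟩
  · by_contra h
    exact hp (hfU (subset_tsupport _ h))
  · rw [← setLIntegral_one]
    refine (lintegral_mono_ae ?_).trans (setLIntegral_le_lintegral K _)
    refine (ae_restrict_iff' hK.measurableSet).2 (ae_of_all _ fun y hy => ?_)
    simp [hf1 (show (x, y) ∈ ({x} : Set X) ×ˢ K from ⟨rfl, hy⟩)]

theorem lintegral_slice_le {U : Set (X × Y)} (hU : IsOpen U) {f : X × Y → ℝ}
    (h01 : ∀ p, f p ∈ Icc (0 : ℝ) 1) (h0 : ∀ p ∉ U, f p = 0) (x : X) :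
    ∫⁻ y, ENNReal.ofReal (f (x, y)) ∂ν ≤ ν {y | (x, y) ∈ U} := by
  have hUx : IsOpen {y | (x, y) ∈ U} := hU.preimage (by fun_prop : Continuous fun y : Y => (x, y))
  rw [← lintegral_indicator_one hUx.measurableSet]
  refine lintegral_mono fun y => ?_
  by_cases hy : (x, y) ∈ U
  · simpa [indicator, hy] using (h01 (x, y)).2
  · simp [h0 _ hy]

theorem continuous_lintegral_slice {f : X × Y → ℝ} (hf : Continuous f)
    (hf' : HasCompactSupport f) (h0 : ∀ p, 0 ≤ f p) :
    Continuous fun x => ∫⁻ y, ENNReal.ofReal (f (x, y)) ∂ν := by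
  have hs : ∀ x, ∫⁻ y, ENNReal.ofReal (f (x, y)) ∂ν = ENNReal.ofReal (∫ y, f (x, y) ∂ν) :=
    fun x => (ofReal_integral_eq_lintegral_ofReal (Continuous.integrable_of_hasCompactSupport
      (by fun_prop) (hasCompactSupport_slice_right hf' x)) (ae_of_all _ fun y => h0 _)).symm
  simp only [hs]
  exact ENNReal.continuous_ofReal.comp (continuous_integral_slice ν hf hf')

/-- Lower semicontinuity: near x the slice measure dominates a continuous function that already
exceeds c at x. -/
theorem isOpen_setOf_lt_measure_slice {U : Set (X × Y)} (hU : IsOpen U) (c : ℝ≥0∞) :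
    IsOpen {x | c < ν {y | (x, y) ∈ U}} := by
  refine isOpen_iff_mem_nhds.2 fun x hx => ?_
  obtain ⟨f, hf, hf', h01, hfU, hc⟩ := exists_lt_lintegral_of_lt_measure_slice ν hU hx
  filter_upwards [((continuous_lintegral_slice ν hf hf' fun p => (h01 p).1).tendsto x).eventually
    (lt_mem_nhds hc)] with x' hx'
  exact hx'.trans_le (lintegral_slice_le ν hU h01 hfU x')

/-- Markov's inequality for the slices of an open set. -/
theorem mul_measure_setOf_lt_measure_slice_le {U : Set (X × Y)}
    (hU : IsOpen U) (c : ℝ≥0∞) :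
    c * μ {x | c < ν {y | (x, y) ∈ U}} ≤ radonProd μ ν U := by
  rw [(isOpen_setOf_lt_measure_slice ν hU c).measure_eq_iSup_isCompact, ENNReal.mul_iSup]
  refine iSup_le fun K => ?_
  rw [ENNReal.mul_iSup]
  refine iSup_le fun hKO => ?_
  rw [ENNReal.mul_iSup]
  refine iSup_le fun hK => ?_
  -- A single test function below the indicator of `U` serves all of K: local choices exist by the
  -- previous lemmas, and finitely many are combined by taking maxima.
  have key : ∃ f : X × Y → ℝ, Continuous f ∧ HasCompactSupport f ∧ (∀ p, f p ∈ Icc (0 : ℝ) 1) ∧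
      (∀ p ∉ U, f p = 0) ∧ ∀ x ∈ K, c ≤ ∫⁻ y, ENNReal.ofReal (f (x, y)) ∂ν := by
    refine hK.induction_on (p := fun K => ∃ f : X × Y → ℝ, Continuous f ∧ HasCompactSupport f ∧
      (∀ p, f p ∈ Icc (0 : ℝ) 1) ∧ (∀ p ∉ U, f p = 0) ∧
      ∀ x ∈ K, c ≤ ∫⁻ y, ENNReal.ofReal (f (x, y)) ∂ν) ?_ ?_ ?_ ?_
    · exact ⟨0, continuous_zero, HasCompactSupport.zero, by simp, by simp, by simp⟩
    · rintro s t hst ⟨f, h1, h2, h3, h4, h5⟩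
      exact ⟨f, h1, h2, h3, h4, fun x hx => h5 x (hst hx)⟩
    · rintro s t ⟨f, h1, h2, h3, h4, h5⟩ ⟨g, g1, g2, g3, g4, g5⟩
      refine ⟨fun p => max (f p) (g p), h1.max g1, ?_, fun p => ?_, fun p hp => ?_, ?_⟩
      · refine HasCompactSupport.intro (h2.isCompact.union g2.isCompact) fun p hp => ?_
        rw [mem_union, not_or] at hp
        simp [image_eq_zero_of_notMem_tsupport hp.1, image_eq_zero_of_notMem_tsupport hp.2]
      · exact ⟨(h3 p).1.trans (le_max_left _ _), max_le (h3 p).2 (g3 p).2⟩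
      · simp [h4 p hp, g4 p hp]
      · rintro x (hx | hx)
        · exact (h5 x hx).trans (lintegral_mono fun y => ENNReal.ofReal_le_ofReal (le_max_left _ _))
        · exact (g5 x hx).trans
            (lintegral_mono fun y => ENNReal.ofReal_le_ofReal (le_max_right _ _))
    · intro x hx
      obtain ⟨f, hf, hf', h01, hfU, hc⟩ := exists_lt_lintegral_of_lt_measure_slice ν hU (hKO hx)
      refine ⟨_, mem_nhdsWithin_of_mem_nhds (((continuous_lintegral_slice ν hf hf'
        fun p => (h01 p).1).tendsto x).eventually (lt_mem_nhds hc)), f, hf, hf', h01, hfU,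
        fun x' hx' => le_of_lt hx'⟩
  obtain ⟨f, hf, hf', h01, hfU, hc⟩ := key
  calc c * μ K = ∫⁻ _ in K, c ∂μ := (setLIntegral_const K c).symm
    _ ≤ ∫⁻ x in K, ∫⁻ y, ENNReal.ofReal (f (x, y)) ∂ν ∂μ :=
      lintegral_mono_ae ((ae_restrict_iff' hK.measurableSet).2 (ae_of_all _ hc))
    _ ≤ ∫⁻ x, ∫⁻ y, ENNReal.ofReal (f (x, y)) ∂ν ∂μ := setLIntegral_le_lintegral K _
    _ = ∫⁻ p, ENNReal.ofReal (f p) ∂(radonProd μ ν) :=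
      (lintegral_radonProd_of_hasCompactSupport μ ν hf hf' fun p => (h01 p).1).symm
    _ ≤ radonProd μ ν U := by
      rw [← lintegral_indicator_one hU.measurableSet]
      refine lintegral_mono fun p => ?_
      by_cases hp : p ∈ U
      · simpa [indicator, hp] using (h01 p).2
      · simp [hfU _ hp]

/-- Cover the null set by open sets Uₙ of measure below 2⁻ⁿ · 2⁻ⁿ. Markov spends one factor on the
threshold for the slices and the other on the measure of the exceptional x, which is therefore
summable. By Borel–Cantelli almost every x has slices of measure at most 2⁻ⁿ for all large n. -/
theorem ae_ae_of_ae_radonProd {P : X × Y → Prop}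
    (h : ∀ᵐ p ∂(radonProd μ ν), P p) : ∀ᵐ x ∂μ, ∀ᵐ y ∂ν, P (x, y) := by
  have h0 : radonProd μ ν {p | ¬ P p} = 0 := h
  have hε : ∀ n : ℕ, (0 : ℝ≥0∞) < 2⁻¹ ^ n * 2⁻¹ ^ n := fun n => by
    rw [← mul_pow]
    exact ENNReal.pow_pos (by simp) n
  have hU : ∀ n : ℕ, ∃ U ⊇ {p | ¬ P p}, IsOpen U ∧ radonProd μ ν U < 2⁻¹ ^ n * 2⁻¹ ^ n := fun n =>
    Set.exists_isOpen_lt_of_lt _ _ (by rw [h0]; exact hε n)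
  choose U hPU hUo hUlt using hU
  have hle : ∀ n : ℕ, μ {x | (2⁻¹ : ℝ≥0∞) ^ n < ν {y | (x, y) ∈ U n}} ≤ 2⁻¹ ^ n := fun n => by
    have h1 := (mul_measure_setOf_lt_measure_slice_le μ ν (hUo n) (2⁻¹ ^ n)).trans (hUlt n).le
    exact (ENNReal.mul_le_mul_iff_right (ENNReal.pow_pos (by simp) n).ne'
      (ENNReal.pow_ne_top (by simp))).1 h1
  have hlim : Tendsto (fun n : ℕ => (2⁻¹ : ℝ≥0∞) ^ n) atTop (𝓝 0) :=
    ENNReal.tendsto_pow_atTop_nhds_zero_of_lt_one (by simp)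
  have hsum : ∑' n, μ {x | (2⁻¹ : ℝ≥0∞) ^ n < ν {y | (x, y) ∈ U n}} ≠ ∞ :=
    ne_top_of_le_ne_top (by simp [ENNReal.tsum_geometric]) (ENNReal.tsum_le_tsum hle)
  filter_upwards [ae_eventually_notMem hsum] with x hx
  refine le_antisymm (ge_of_tendsto hlim ?_) bot_le
  filter_upwards [hx] with n hn
  refine (measure_mono ?_).trans (not_lt.1 hn)
  intro y hy
  exact hPU n hy

end Slicing

/-! ### Rapidly convergent approximation by compactly supported continuous functions. -/

section Approximation

variable {X : Type*} [MeasurableSpace X] {μ : Measure X}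

theorem enorm_le_enorm_zero_add_tsum (u : ℕ → ℂ) (n : ℕ) :
    ‖u n‖ₑ ≤ ‖u 0‖ₑ + ∑' k, ‖u (k + 1) - u k‖ₑ := by
  have h1 : ‖u n‖ₑ ≤ ‖u 0‖ₑ + ∑ k ∈ Finset.range n, ‖u (k + 1) - u k‖ₑ := by
    induction n with
    | zero => simp
    | succ n ih =>
      rw [Finset.sum_range_succ, ← add_assoc]
      calc ‖u (n + 1)‖ₑ = ‖u n + (u (n + 1) - u n)‖ₑ := by ring_nf
        _ ≤ ‖u n‖ₑ + ‖u (n + 1) - u n‖ₑ := enorm_add_le _ _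
        _ ≤ _ := by gcongr
  exact h1.trans (add_le_add le_rfl (ENNReal.sum_le_tsum _))

/-- Dominated convergence with the total variation of the sequence as majorant. This criterion is
inherited by slices, so the same sequence works on the product and on almost every slice. -/
theorem integrable_and_tendsto_integral_of_lintegral_tsum_ne_top {g : ℕ → X → ℂ} {f : X → ℂ}
    (hg : ∀ n, AEStronglyMeasurable (g n) μ)
    (hsum : ∫⁻ x, ‖g 0 x‖ₑ + ∑' n, ‖g (n + 1) x - g n x‖ₑ ∂μ ≠ ∞)
    (hlim : ∀ᵐ x ∂μ, Tendsto (fun n => g n x) atTop (𝓝 (f x))) :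
    Integrable f μ ∧ Tendsto (fun n => ∫ x, g n x ∂μ) atTop (𝓝 (∫ x, f x ∂μ)) := by
  set S : X → ℝ≥0∞ := fun x => ‖g 0 x‖ₑ + ∑' n, ‖g (n + 1) x - g n x‖ₑ with hS
  have hSm : AEMeasurable S μ :=
    (hg 0).enorm.add (AEMeasurable.tsum fun n => ((hg (n + 1)).sub (hg n)).enorm)
  have hle : ∀ n x, ‖g n x‖ₑ ≤ S x := fun n x => enorm_le_enorm_zero_add_tsum (fun k => g k x) n
  have hfin : ∀ᵐ x ∂μ, S x < ∞ := ae_lt_top' hSm hsum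
  have hb : ∀ n, ∀ᵐ x ∂μ, ‖g n x‖ ≤ (S x).toReal := fun n => by
    filter_upwards [hfin] with x hx
    rw [← toReal_enorm]
    exact ENNReal.toReal_mono hx.ne (hle n x)
  have hSi : Integrable (fun x => (S x).toReal) μ := integrable_toReal_of_lintegral_ne_top hSm hsum
  refine ⟨hSi.mono' (aestronglyMeasurable_of_tendsto_ae atTop hg hlim) ?_,
    tendsto_integral_of_dominated_convergence _ hg hSi hb hlim⟩
  filter_upwards [ae_all_iff.2 hb, hlim] with x hx hl
  exact le_of_tendsto hl.norm (Eventually.of_forall hx)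

/-- Density of `C_c` in `L¹`; the space need not be normal. -/
theorem exists_hasCompactSupport_lintegral_sub_le [TopologicalSpace X] [T2Space X]
    [LocallyCompactSpace X] [BorelSpace X] [μ.Regular] {f : X → ℂ} (hf : Integrable f μ)
    {ε : ℝ≥0∞} (hε : ε ≠ 0) :
    ∃ g : X → ℂ, HasCompactSupport g ∧ ∫⁻ x, ‖f x - g x‖ₑ ∂μ ≤ ε ∧ Continuous g ∧
      Integrable g μ := by
  suffices H : ∃ g : X → ℂ, eLpNorm (f - g) 1 μ ≤ ε ∧ Continuous g ∧ HasCompactSupport g by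
    obtain ⟨g, hg, hgc, hgs⟩ := H
    refine ⟨g, hgs, ?_, hgc, hgc.integrable_of_hasCompactSupport hgs⟩
    rwa [eLpNorm_one_eq_lintegral_enorm] at hg
  refine (memLp_one_iff_integrable.2 hf).induction_dense ENNReal.one_ne_top
    (fun g : X → ℂ => Continuous g ∧ HasCompactSupport g) ?_ ?_ ?_ hε
  · intro c t ht htμ ε hε
    obtain ⟨η, ηpos, hη⟩ : ∃ η : ℝ≥0, 0 < η ∧
        ∀ s : Set X, μ s ≤ η → eLpNorm (s.indicator fun _ => c) 1 μ ≤ ε :=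
      exists_eLpNorm_indicator_le ENNReal.one_ne_top c hε
    have hη2 : (η : ℝ≥0∞) / 2 ≠ 0 := by simp [ηpos.ne']
    obtain ⟨s, st, hs, hsc, μs⟩ := ht.exists_isCompact_isClosed_sdiff_lt htμ.ne hη2
    obtain ⟨V, hsV, hV, -, hVs⟩ := hsc.measurableSet.exists_isOpen_sdiff_lt
      ((measure_mono st).trans_lt htμ).ne hη2
    obtain ⟨h, h1, hc, hU, h01⟩ := exists_continuousMap_one_of_isCompact_subset_isOpen hs hV hsV
    have h0 : ∀ x ∉ V, h x = 0 := fun x hx => by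
      by_contra h
      exact hx (hU (subset_tsupport _ h))
    refine ⟨fun x => h x * c, ?_, by fun_prop, ?_⟩
    -- The approximant and the indicator agree off V \ s ∪ t \ s and differ there by at most ‖c‖.
    · refine (eLpNorm_mono fun x => ?_).trans (hη (V \ s ∪ t \ s) ?_)
      · by_cases hxs : x ∈ s
        · simp [h1 hxs, st hxs]
        · by_cases hxV : x ∈ V
          · have hx := h01 x
            rw [indicator_of_mem (show x ∈ V \ s ∪ t \ s from Or.inl ⟨hxV, hxs⟩)]
            by_cases hxt : x ∈ t
            · simp only [Pi.sub_apply, indicator_of_mem hxt]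
              rw [show (h x : ℂ) * c - c = ((h x - 1 : ℝ) : ℂ) * c by push_cast; ring, norm_mul,
                Complex.norm_real]
              refine mul_le_of_le_one_left (norm_nonneg _) ?_
              rw [Real.norm_eq_abs, abs_le]
              constructor <;> linarith [hx.1, hx.2]
            · simp only [Pi.sub_apply, indicator_of_notMem hxt, sub_zero, norm_mul,
                Complex.norm_real]
              refine mul_le_of_le_one_left (norm_nonneg _) ?_
              rw [Real.norm_eq_abs, abs_le]
              constructor <;> linarith [hx.1, hx.2]
          · by_cases hxt : x ∈ t <;> simp [h0 x hxV, hxt, hxV, hxs]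
      · calc μ (V \ s ∪ t \ s) ≤ μ (V \ s) + μ (t \ s) := measure_union_le _ _
          _ ≤ η / 2 + η / 2 := add_le_add hVs.le μs.le
          _ = η := ENNReal.add_halves _
    · refine HasCompactSupport.intro hc fun x hx => ?_
      simp [image_eq_zero_of_notMem_tsupport hx]
  · rintro f g ⟨hf, hf'⟩ ⟨hg, hg'⟩
    exact ⟨hf.add hg, hf'.add hg'⟩
  · rintro f ⟨hf, hf'⟩
    exact (hf.integrable_of_hasCompactSupport hf').aestronglyMeasurable

theorem exists_seq_hasCompactSupport_tendsto [TopologicalSpace X] [T2Space X]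
    [LocallyCompactSpace X] [BorelSpace X] [μ.Regular] {f : X → ℂ} (hf : Integrable f μ) :
    ∃ g : ℕ → X → ℂ, (∀ n, Continuous (g n)) ∧ (∀ n, HasCompactSupport (g n)) ∧
      ∫⁻ x, ‖g 0 x‖ₑ + ∑' n, ‖g (n + 1) x - g n x‖ₑ ∂μ ≠ ∞ ∧
      ∀ᵐ x ∂μ, Tendsto (fun n => g n x) atTop (𝓝 (f x)) := by
  -- Summability of the errors 2⁻ⁿ yields both the integrable total variation and convergence almost
  -- everywhere.
  have h := fun n : ℕ => exists_hasCompactSupport_lintegral_sub_le hf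
    (ε := 2⁻¹ ^ n) (ENNReal.pow_pos (by simp) n).ne'
  choose g hgs hgle hgc hgi using h
  have hm : ∀ n, AEMeasurable (fun x => ‖f x - g n x‖ₑ) μ := fun n =>
    (hf.aestronglyMeasurable.sub (hgi n).aestronglyMeasurable).enorm
  have hgeo : ∑' n : ℕ, (2⁻¹ : ℝ≥0∞) ^ n ≠ ∞ := by simp [ENNReal.tsum_geometric]
  have hsum : ∑' n, ∫⁻ x, ‖f x - g n x‖ₑ ∂μ ≠ ∞ :=
    ne_top_of_le_ne_top hgeo (ENNReal.tsum_le_tsum hgle)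
  refine ⟨g, hgc, hgs, ?_, ?_⟩
  · rw [lintegral_add_left' (hgi 0).aestronglyMeasurable.enorm]
    refine ENNReal.add_ne_top.2 ⟨(hgi 0).2.ne, ?_⟩
    refine ne_of_eq_of_ne (lintegral_tsum fun n =>
      ((hgi (n + 1)).aestronglyMeasurable.sub (hgi n).aestronglyMeasurable).enorm) ?_
    have hle : ∀ n, ∫⁻ x, ‖g (n + 1) x - g n x‖ₑ ∂μ ≤ 2⁻¹ ^ n + 2⁻¹ ^ n := fun n =>
      calc ∫⁻ x, ‖g (n + 1) x - g n x‖ₑ ∂μ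
          ≤ ∫⁻ x, ‖f x - g n x‖ₑ + ‖f x - g (n + 1) x‖ₑ ∂μ := lintegral_mono fun x => by
            rw [show g (n + 1) x - g n x = (f x - g n x) - (f x - g (n + 1) x) by ring]
            exact enorm_sub_le
        _ = _ := lintegral_add_left' (hm n) _
        _ ≤ _ := add_le_add (hgle n) ((hgle (n + 1)).trans
            (pow_le_pow_right_of_le_one' (by simp) n.le_succ))
    refine ne_top_of_le_ne_top ?_ (ENNReal.tsum_le_tsum hle)
    rw [ENNReal.tsum_add]
    exact ENNReal.add_ne_top.2 ⟨hgeo, hgeo⟩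
  · have : ∫⁻ x, ∑' n, ‖f x - g n x‖ₑ ∂μ ≠ ∞ := by rwa [lintegral_tsum hm]
    filter_upwards [ae_lt_top' (AEMeasurable.tsum hm) this] with x hx
    have h0 := ENNReal.tendsto_atTop_zero_of_tsum_ne_top hx.ne
    rw [tendsto_iff_edist_tendsto_0]
    refine h0.congr fun n => ?_
    rw [edist_comm, edist_eq_enorm_sub]

end Approximation

/-! ### Fubini's theorem without σ-finiteness. -/

section Fubini

variable {X Y : Type*} [TopologicalSpace X] [T2Space X] [LocallyCompactSpace X]
  [MeasurableSpace X] [BorelSpace X] [TopologicalSpace Y] [T2Space Y] [LocallyCompactSpace Y]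
  [MeasurableSpace Y] [BorelSpace Y]

variable (μ : Measure X) [μ.Regular] (ν : Measure Y) [ν.Regular]

theorem lintegral_enorm_radonProd_of_hasCompactSupport {f : X × Y → ℂ} (hf : Continuous f)
    (hf' : HasCompactSupport f) :
    ∫⁻ p, ‖f p‖ₑ ∂(radonProd μ ν) = ∫⁻ x, ∫⁻ y, ‖f (x, y)‖ₑ ∂ν ∂μ := by
  simpa only [ofReal_norm] using
    lintegral_radonProd_of_hasCompactSupport μ ν hf.norm hf'.norm fun p => norm_nonneg _

theorem continuous_lintegral_enorm_slice {f : X × Y → ℂ} (hf : Continuous f)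
    (hf' : HasCompactSupport f) : Continuous fun x => ∫⁻ y, ‖f (x, y)‖ₑ ∂ν := by
  simpa only [ofReal_norm] using
    continuous_lintegral_slice ν hf.norm hf'.norm fun p => norm_nonneg _

variable {μ ν}

/-- Fubini's theorem for the Radon product. -/
theorem MeasureTheory.Integrable.radonProd_fubini {f : X × Y → ℂ}
    (hf : Integrable f (radonProd μ ν)) :
    (∀ᵐ x ∂μ, Integrable (fun y => f (x, y)) ν) ∧ Integrable (fun x => ∫ y, f (x, y) ∂ν) μ ∧
      ∫ p, f p ∂(radonProd μ ν) = ∫ x, ∫ y, f (x, y) ∂ν ∂μ := by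
  obtain ⟨g, hgc, hgs, hsum, hlim⟩ := exists_seq_hasCompactSupport_tendsto hf
  have hdc : ∀ n, Continuous (fun p => g (n + 1) p - g n p) := fun n => (hgc _).sub (hgc _)
  have hds : ∀ n, HasCompactSupport (fun p => g (n + 1) p - g n p) := fun n => (hgs _).sub (hgs _)
  have hsc : ∀ n x, Continuous fun y => g n (x, y) := fun n x => by have := hgc n; fun_prop
  have hsi : ∀ n x, Integrable (fun y => g n (x, y)) ν := fun n x =>
    (hsc n x).integrable_of_hasCompactSupport (hasCompactSupport_slice_right (hgs n) x)
  have hS : ∀ x, ∫⁻ y, ‖g 0 (x, y)‖ₑ + ∑' n, ‖g (n + 1) (x, y) - g n (x, y)‖ₑ ∂ν =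
      ∫⁻ y, ‖g 0 (x, y)‖ₑ ∂ν + ∑' n, ∫⁻ y, ‖g (n + 1) (x, y) - g n (x, y)‖ₑ ∂ν := fun x => by
    rw [lintegral_add_left' (hsi 0 x).aestronglyMeasurable.enorm]
    exact congrArg _ (lintegral_tsum fun n =>
      ((hsi (n + 1) x).aestronglyMeasurable.sub (hsi n x).aestronglyMeasurable).enorm)
  have hSm : AEMeasurable
      (fun x => ∫⁻ y, ‖g 0 (x, y)‖ₑ + ∑' n, ‖g (n + 1) (x, y) - g n (x, y)‖ₑ ∂ν) μ := by
    simp only [hS]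
    exact (continuous_lintegral_enorm_slice ν (hgc 0) (hgs 0)).measurable.aemeasurable.add
      (AEMeasurable.tsum fun n =>
        (continuous_lintegral_enorm_slice ν (hdc n) (hds n)).measurable.aemeasurable)
  -- Each term is continuous with compact support, where iterated and product integrals agree, so
  -- the majorant has the same finite integral as on the product.
  have hSfin : ∫⁻ x, ∫⁻ y, ‖g 0 (x, y)‖ₑ + ∑' n, ‖g (n + 1) (x, y) - g n (x, y)‖ₑ ∂ν ∂μ ≠ ∞ := by
    simp only [hS]
    rw [lintegral_add_left' (continuous_lintegral_enorm_slice ν (hgc 0)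
      (hgs 0)).measurable.aemeasurable, lintegral_tsum fun n =>
        (continuous_lintegral_enorm_slice ν (hdc n) (hds n)).measurable.aemeasurable]
    rw [lintegral_add_left' (hgc 0).measurable.enorm.aemeasurable, lintegral_tsum fun n =>
      (hdc n).measurable.enorm.aemeasurable] at hsum
    rw [lintegral_enorm_radonProd_of_hasCompactSupport μ ν (hgc 0) (hgs 0)] at hsum
    simp_rw [fun n => lintegral_enorm_radonProd_of_hasCompactSupport μ ν (hdc n) (hds n)] at hsum
    exact hsum
  have hx : ∀ᵐ x ∂μ, Integrable (fun y => f (x, y)) ν ∧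
      Tendsto (fun n => ∫ y, g n (x, y) ∂ν) atTop (𝓝 (∫ y, f (x, y) ∂ν)) := by
    filter_upwards [ae_ae_of_ae_radonProd μ ν hlim, ae_lt_top' hSm hSfin] with x h1 h2
    exact integrable_and_tendsto_integral_of_lintegral_tsum_ne_top
      (fun n => (hsi n x).aestronglyMeasurable) h2.ne h1
  have hμ := integrable_and_tendsto_integral_of_lintegral_tsum_ne_top (μ := μ)
    (g := fun n x => ∫ y, g n (x, y) ∂ν) (f := fun x => ∫ y, f (x, y) ∂ν)
    (fun n => ((continuous_integral_slice ν (hgc n) (hgs n)).integrable_of_hasCompactSupport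
      (hasCompactSupport_integral_slice ν (hgs n))).aestronglyMeasurable)
    (ne_top_of_le_ne_top hSfin (lintegral_mono fun x => by
      rw [hS]
      gcongr with n
      · exact enorm_integral_le_lintegral_enorm _
      · rw [← integral_sub (hsi _ x) (hsi _ x)]
        exact enorm_integral_le_lintegral_enorm _))
    (hx.mono fun x h => h.2)
  refine ⟨hx.mono fun x h => h.1, hμ.1, tendsto_nhds_unique
    (integrable_and_tendsto_integral_of_lintegral_tsum_ne_top (fun n =>
      ((hgc n).integrable_of_hasCompactSupport (hgs n)).aestronglyMeasurable) hsum hlim).2 ?_⟩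
  refine hμ.2.congr fun n => ?_
  exact (integral_radonProd_of_hasCompactSupport μ ν (hgc n) (hgs n)).symm

end Fubini

/-! ### Measure-preserving swaps, reassociations and shears. -/

section Homeomorphisms

variable {X Y Z : Type*} [TopologicalSpace X] [T2Space X] [LocallyCompactSpace X]
  [MeasurableSpace X] [BorelSpace X] [TopologicalSpace Y] [T2Space Y] [LocallyCompactSpace Y]
  [MeasurableSpace Y] [BorelSpace Y] [TopologicalSpace Z] [T2Space Z] [LocallyCompactSpace Z]
  [MeasurableSpace Z] [BorelSpace Z]

/-- Regular measures are determined by their integrals on C_c, where the Radon product is an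
iterated integral. Invariance is thereby reduced to invariance in one variable at a time. -/
theorem measurePreserving_homeomorph_of_integral_eq (e : X ≃ₜ Y) (μ : Measure X) [μ.Regular]
    (ν : Measure Y) [ν.Regular]
    (h : ∀ f : Y → ℂ, Continuous f → HasCompactSupport f → ∫ x, f (e x) ∂μ = ∫ y, f y ∂ν) :
    MeasurePreserving e μ ν := by
  refine ⟨e.measurable, ?_⟩
  have := Measure.Regular.map (μ := μ) e
  refine Measure.ext_of_integral_eq_on_compactlySupported fun f => ?_
  rw [e.measurableEmbedding.integral_map]
  have := h (fun y => (f y : ℂ)) (by fun_prop) (f.hasCompactSupport.comp_left (g := ((↑) : ℝ → ℂ))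
    Complex.ofReal_zero)
  simpa only [integral_complex_ofReal, Complex.ofReal_inj] using this

section Symmetries

variable (μ : Measure X) [μ.Regular] (ν : Measure Y) [ν.Regular]

theorem measurePreserving_swap_radonProd :
    MeasurePreserving Prod.swap (radonProd μ ν) (radonProd ν μ) := by
  refine measurePreserving_homeomorph_of_integral_eq (Homeomorph.prodComm X Y) _ _
    fun f hf hf' => ?_
  rw [integral_radonProd_of_hasCompactSupport μ ν (f := fun p => f (Homeomorph.prodComm X Y p))
    (by fun_prop) (hf'.comp_homeomorph _), integral_radonProd_of_hasCompactSupport ν μ hf hf']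
  exact integral_integral_swap_of_hasCompactSupport (f := fun x y => f (y, x)) (by fun_prop)
    (hf'.comp_homeomorph (Homeomorph.prodComm X Y))

theorem measurePreserving_prodAssoc_radonProd (ρ : Measure Z) [ρ.Regular] :
    MeasurePreserving (Homeomorph.prodAssoc X Y Z) (radonProd (radonProd μ ν) ρ)
      (radonProd μ (radonProd ν ρ)) := by
  refine measurePreserving_homeomorph_of_integral_eq (Homeomorph.prodAssoc X Y Z) _ _
    fun f hf hf' => ?_
  have hc : Continuous fun p => f (Homeomorph.prodAssoc X Y Z p) := by fun_prop
  have hs : HasCompactSupport fun p => f (Homeomorph.prodAssoc X Y Z p) :=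
    hf'.comp_homeomorph (Homeomorph.prodAssoc X Y Z)
  rw [integral_radonProd_of_hasCompactSupport _ _ hc hs,
    integral_radonProd_of_hasCompactSupport _ _ (continuous_integral_slice ρ hc hs)
      (hasCompactSupport_integral_slice ρ hs), integral_radonProd_of_hasCompactSupport _ _ hf hf']
  exact integral_congr_ae (ae_of_all _ fun x => (integral_radonProd_of_hasCompactSupport ν ρ
    (f := fun q => f (x, q)) (by fun_prop) (hasCompactSupport_slice_right hf' x)).symm)

variable {G : Type*} [Group G] [TopologicalSpace G] [IsTopologicalGroup G] [T2Space G]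
  [LocallyCompactSpace G] [MeasurableSpace G] [BorelSpace G]

/-- The shear `(x, y) ↦ (x, g x * y)`. -/
def Homeomorph.shearOfContinuousMap (g : C(X, G)) : X × G ≃ₜ X × G where
  toFun p := (p.1, g p.1 * p.2)
  invFun p := (p.1, (g p.1)⁻¹ * p.2)
  left_inv p := by simp
  right_inv p := by simp
  continuous_toFun := by fun_prop
  continuous_invFun := by fun_prop

theorem measurePreserving_shear_right (g : C(X, G)) (m : Measure G) [m.Regular]
    [m.IsMulLeftInvariant] :
    MeasurePreserving (fun p : X × G => (p.1, g p.1 * p.2)) (radonProd μ m) (radonProd μ m) := by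
  refine measurePreserving_homeomorph_of_integral_eq (Homeomorph.shearOfContinuousMap g) _ _
    fun f hf hf' => ?_
  rw [integral_radonProd_of_hasCompactSupport μ m hf hf', integral_radonProd_of_hasCompactSupport μ m
    (f := fun p => f (Homeomorph.shearOfContinuousMap g p)) (by fun_prop) (hf'.comp_homeomorph _)]
  exact integral_congr_ae (ae_of_all _ fun x =>
    integral_mul_left_eq_self (fun y => f (x, y)) (g x))

theorem measurePreserving_shear_left (g : C(Y, G)) (m : Measure G) [m.Regular]
    [m.IsMulLeftInvariant] :
    MeasurePreserving (fun p : G × Y => (g p.2 * p.1, p.2)) (radonProd m ν) (radonProd m ν) :=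
  (measurePreserving_swap_radonProd ν m).comp ((measurePreserving_shear_right ν g m).comp
    (measurePreserving_swap_radonProd m ν))

variable {H : Type*} [Group H] [TopologicalSpace H] [IsTopologicalGroup H] [T2Space H]
  [LocallyCompactSpace H] [MeasurableSpace H] [BorelSpace H]

instance isMulLeftInvariant_radonProd (m : Measure G) [m.Regular] [m.IsMulLeftInvariant]
    (n : Measure H) [n.Regular] [n.IsMulLeftInvariant] :
    (radonProd m n).IsMulLeftInvariant := by
  refine ⟨fun g => (MeasurePreserving.map_eq ?_)⟩
  exact (measurePreserving_shear_right m (ContinuousMap.const G g.2) n).comp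
    (measurePreserving_shear_left n (ContinuousMap.const H g.1) m)

end Symmetries

/-! ### Integrability of tensor products. -/

section Tensor

variable {μ : Measure X} [μ.Regular] {ν : Measure Y} [ν.Regular]

theorem radonProd_prod_le {U : Set X} {V : Set Y} (hU : IsOpen U) (hV : IsOpen V) :
    radonProd μ ν (U ×ˢ V) ≤ μ U * ν V := by
  rw [(hU.prod hV).measure_eq_iSup_isCompact]
  refine iSup_le fun K => iSup_le fun hKU => iSup_le fun hK => ?_
  obtain ⟨h, h1, hc, hUV, h01⟩ :=
    exists_continuousMap_one_of_isCompact_subset_isOpen hK (hU.prod hV) hKU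
  have h0 : ∀ p ∉ U ×ˢ V, h p = 0 := fun p hp => by
    by_contra h
    exact hp (hUV (subset_tsupport _ h))
  calc radonProd μ ν K = ∫⁻ _ in K, 1 ∂(radonProd μ ν) := by simp
    _ ≤ ∫⁻ p in K, ENNReal.ofReal (h p) ∂(radonProd μ ν) :=
      lintegral_mono_ae ((ae_restrict_iff' hK.measurableSet).2 (ae_of_all _ fun p hp => by
        simp [h1 hp]))
    _ ≤ ∫⁻ p, ENNReal.ofReal (h p) ∂(radonProd μ ν) := setLIntegral_le_lintegral K _
    _ = ∫⁻ x, ∫⁻ y, ENNReal.ofReal (h (x, y)) ∂ν ∂μ :=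
      lintegral_radonProd_of_hasCompactSupport μ ν h.continuous hc fun p => (h01 p).1
    _ ≤ ∫⁻ x, U.indicator (fun _ => ν V) x ∂μ := lintegral_mono fun x => by
      by_cases hx : x ∈ U
      · rw [indicator_of_mem hx, ← lintegral_indicator_one hV.measurableSet]
        refine lintegral_mono fun y => ?_
        by_cases hy : y ∈ V
        · simpa [indicator, hy] using (h01 (x, y)).2
        · simp [h0 (x, y) fun h => hy h.2]
      · simp [h0 (x, _) fun h => hx h.1]
    _ = μ U * ν V := by rw [lintegral_indicator_const hU.measurableSet, mul_comm]

/-- Finiteness of ν V matters: without σ-finiteness a null set times all of Y need not be null. -/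
theorem radonProd_prod_eq_zero_left {N : Set X} {V : Set Y} (hN : μ N = 0) (hV : IsOpen V)
    (hV' : ν V ≠ ∞) : radonProd μ ν (N ×ˢ V) = 0 := by
  refine le_antisymm (ENNReal.le_of_forall_pos_le_add fun ε hε _ => ?_) bot_le
  have hδ : μ N < ε / (ν V + 1) := by
    rw [hN]
    exact ENNReal.div_pos (by exact_mod_cast hε.ne') (by simp [hV'])
  obtain ⟨U, hNU, hU, hUε⟩ := Set.exists_isOpen_lt_of_lt N _ hδ
  calc radonProd μ ν (N ×ˢ V) ≤ radonProd μ ν (U ×ˢ V) := measure_mono (prod_mono hNU le_rfl)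
    _ ≤ μ U * ν V := radonProd_prod_le hU hV
    _ ≤ ε / (ν V + 1) * (ν V + 1) := mul_le_mul' hUε.le le_self_add
    _ = 0 + ε := by rw [zero_add, ENNReal.div_mul_cancel (by simp) (by simp [hV'])]

theorem radonProd_prod_eq_zero_right {U : Set X} {N : Set Y} (hN : ν N = 0) (hU : IsOpen U)
    (hU' : μ U ≠ ∞) : radonProd μ ν (U ×ˢ N) = 0 := by
  have h := (measurePreserving_swap_radonProd μ ν).quasiMeasurePreserving.preimage_null
    (radonProd_prod_eq_zero_left (μ := ν) (ν := μ) hN hU hU')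
  rwa [preimage_swap_prod] at h

/-- Index `some n` covers the support of k n, and `none` covers the null set where convergence
fails. Off all of these sets the limit is 0, so only countably many sets of finite measure matter.
-/
theorem exists_isOpen_cover_of_tendsto {k : ℕ → X → ℂ} {l : X → ℂ}
    (hk : ∀ n, HasCompactSupport (k n))
    (hl : ∀ᵐ t ∂μ, Tendsto (fun n => k n t) atTop (𝓝 (l t))) :
    ∃ V : Option ℕ → Set X, (∀ i, IsOpen (V i)) ∧ (∀ i, μ (V i) ≠ ∞) ∧
      (∀ n, ∀ t ∉ V (some n), k n t = 0) ∧
      ∀ t ∉ V none, Tendsto (fun n => k n t) atTop (𝓝 (l t)) := by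
  have h1 := fun n => (hk n).isCompact.exists_open_superset_measure_lt_top μ
  choose W hW hWo hWfin using h1
  have hl' : μ {t | ¬ Tendsto (fun n => k n t) atTop (𝓝 (l t))} < 1 := by
    rw [show μ {t | ¬ Tendsto (fun n => k n t) atTop (𝓝 (l t))} = 0 from hl]
    simp
  obtain ⟨U, hNU, hU, hUlt⟩ := Set.exists_isOpen_lt_of_lt _ _ hl'
  refine ⟨fun i => i.elim U W, ?_, ?_, fun n t ht => ?_, fun t ht => ?_⟩
  · rintro (_ | n)
    exacts [hU, hWo n]
  · rintro (_ | n)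
    exacts [(hUlt.trans ENNReal.one_lt_top).ne, (hWfin n).ne]
  · by_contra h
    exact ht (hW n (subset_tsupport _ h))
  · by_contra h
    exact ht (hNU h)

theorem MeasureTheory.Integrable.mul_radonProd {f : X → ℂ} {g : Y → ℂ} (hf : Integrable f μ)
    (hg : Integrable g ν) : Integrable (fun p : X × Y => f p.1 * g p.2) (radonProd μ ν) := by
  obtain ⟨F, hFc, hFs, hFsum, hFlim⟩ := exists_seq_hasCompactSupport_tendsto hf
  obtain ⟨K, hKc, hKs, hKsum, hKlim⟩ := exists_seq_hasCompactSupport_tendsto hg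
  have hFi := fun n => (hFc n).integrable_of_hasCompactSupport (hFs n) (μ := μ)
  have hKi := fun n => (hKc n).integrable_of_hasCompactSupport (hKs n) (μ := ν)
  obtain ⟨U, hUo, hUfin, hU0, hUlim⟩ := exists_isOpen_cover_of_tendsto hFs hFlim
  obtain ⟨V, hVo, hVfin, hV0, hVlim⟩ := exists_isOpen_cover_of_tendsto hKs hKlim
  -- If convergence fails in one coordinate, then outside countably many null rectangles the other
  -- coordinate avoids every covering set. All products and their limit are then 0.
  have hlim : ∀ᵐ p ∂(radonProd μ ν),
      Tendsto (fun n => F n p.1 * K n p.2) atTop (𝓝 (f p.1 * g p.2)) := by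
    have h1 : ∀ᵐ p ∂(radonProd μ ν), ∀ i,
        p ∉ {x | ¬ Tendsto (fun n => F n x) atTop (𝓝 (f x))} ×ˢ V i := ae_all_iff.2 fun i =>
      measure_eq_zero_iff_ae_notMem.1 (radonProd_prod_eq_zero_left hFlim (hVo i) (hVfin i))
    have h2 : ∀ᵐ p ∂(radonProd μ ν), ∀ i,
        p ∉ U i ×ˢ {y | ¬ Tendsto (fun n => K n y) atTop (𝓝 (g y))} := ae_all_iff.2 fun i =>
      measure_eq_zero_iff_ae_notMem.1 (radonProd_prod_eq_zero_right hKlim (hUo i) (hUfin i))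
    filter_upwards [h1, h2] with p hp1 hp2
    by_cases hx : Tendsto (fun n => F n p.1) atTop (𝓝 (f p.1))
    · by_cases hy : Tendsto (fun n => K n p.2) atTop (𝓝 (g p.2))
      · exact hx.mul hy
      · have hF : ∀ n, F n p.1 = 0 := fun n => hU0 n _ fun h => hp2 (some n) ⟨h, hy⟩
        have hf0 : f p.1 = 0 := tendsto_nhds_unique hx (by simp [hF])
        simp [hF, hf0]
    · have hK : ∀ n, K n p.2 = 0 := fun n => hV0 n _ fun h => hp1 (some n) ⟨hx, h⟩
      have hg0 : g p.2 = 0 :=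
        tendsto_nhds_unique (hVlim _ fun h => hp1 none ⟨hx, h⟩) (by simp [hK])
      simp [hK, hg0]
  have hc : ∀ n, Continuous fun p : X × Y => F n p.1 * K n p.2 := fun n => by
    have := hFc n; have := hKc n; fun_prop
  have hs : ∀ n, HasCompactSupport fun p : X × Y => F n p.1 * K n p.2 := fun n => by
    refine HasCompactSupport.intro ((hFs n).isCompact.prod (hKs n).isCompact) fun p hp => ?_
    by_cases h : p.1 ∈ tsupport (F n)
    · simp [image_eq_zero_of_notMem_tsupport fun h' => hp ⟨h, h'⟩]
    · simp [image_eq_zero_of_notMem_tsupport h]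
  have hm : ∀ n, AEStronglyMeasurable (fun p : X × Y => F n p.1 * K n p.2) (radonProd μ ν) :=
    fun n => ((hc n).integrable_of_hasCompactSupport (hs n)).aestronglyMeasurable
  refine ⟨aestronglyMeasurable_of_tendsto_ae atTop hm hlim, ?_⟩
  have hn : ∀ n, ∫⁻ p, ‖F n p.1 * K n p.2‖ₑ ∂(radonProd μ ν) =
      (∫⁻ x, ‖F n x‖ₑ ∂μ) * ∫⁻ y, ‖K n y‖ₑ ∂ν := fun n => by
    rw [lintegral_enorm_radonProd_of_hasCompactSupport μ ν (hc n) (hs n)]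
    simp only [enorm_mul]
    simp_rw [lintegral_const_mul' _ _ enorm_ne_top]
    exact lintegral_mul_const _ (hFc n).enorm.measurable
  -- Fatou's lemma, with the integrals along the sequence bounded by the product of the two
  -- majorants.
  calc ∫⁻ p, ‖f p.1 * g p.2‖ₑ ∂(radonProd μ ν)
      = ∫⁻ p, liminf (fun n => ‖F n p.1 * K n p.2‖ₑ) atTop ∂(radonProd μ ν) :=
        lintegral_congr_ae (hlim.mono fun p hp => hp.enorm.liminf_eq.symm)
    _ ≤ liminf (fun n => ∫⁻ p, ‖F n p.1 * K n p.2‖ₑ ∂(radonProd μ ν)) atTop :=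
        lintegral_liminf_le' fun n => (hm n).enorm
    _ ≤ (∫⁻ x, ‖F 0 x‖ₑ + ∑' n, ‖F (n + 1) x - F n x‖ₑ ∂μ) *
        ∫⁻ y, ‖K 0 y‖ₑ + ∑' n, ‖K (n + 1) y - K n y‖ₑ ∂ν := by
      refine liminf_le_of_le (by isBoundedDefault) fun b hb => ?_
      obtain ⟨n, hbn⟩ := hb.exists
      refine hbn.trans ((hn n).trans_le ?_)
      gcongr with x y
      · exact enorm_le_enorm_zero_add_tsum (fun k => F k x) n
      · exact enorm_le_enorm_zero_add_tsum (fun k => K k y) n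
    _ < ∞ := ENNReal.mul_lt_top hFsum.lt_top hKsum.lt_top

theorem integral_mul_radonProd {f : X → ℂ} {g : Y → ℂ} (hf : Integrable f μ)
    (hg : Integrable g ν) :
    ∫ p : X × Y, f p.1 * g p.2 ∂(radonProd μ ν) = (∫ x, f x ∂μ) * ∫ y, g y ∂ν := by
  rw [(hf.mul_radonProd hg).radonProd_fubini.2.2]
  simp only [integral_const_mul, integral_mul_const]

end Tensor

end Homeomorphisms

/-! ### Characters, and Parseval's formula. -/

section Pontryagin

variable {A : Type*} [CommGroup A] [TopologicalSpace A] [IsTopologicalGroup A]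
  [LocallyCompactSpace A] [T2Space A]

/-- Joint continuity rests on local compactness of A and the compact-open topology; it makes the
Fourier kernels measurable on products. -/
theorem continuous_pontryaginDual_apply :
    Continuous fun p : PontryaginDual A × A => p.1 p.2 := by
  have h := (ContinuousMonoidHom.isInducing_toContinuousMap A Circle).continuous
  exact (continuous_eval (F := C(A, Circle))).comp
    (show Continuous fun p : PontryaginDual A × A =>
      (ContinuousMonoidHom.toContinuousMap (A := A) (B := Circle) p.1, p.2) from
      (h.comp continuous_fst).prodMk continuous_snd)

theorem Continuous.pontryaginDual_apply {P : Type*} [TopologicalSpace P]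
    {f : P → PontryaginDual A} {g : P → A} (hf : Continuous f) (hg : Continuous g) :
    Continuous fun p => f p (g p) :=
  continuous_pontryaginDual_apply.comp (hf.prodMk hg)

theorem MeasureTheory.Integrable.circle_mul {P : Type*} [TopologicalSpace P] [MeasurableSpace P]
    [BorelSpace P] {ρ : Measure P} {f : P → ℂ} (hf : Integrable f ρ) {u : P → Circle}
    (hu : Continuous u) : Integrable (fun p => (u p : ℂ) * f p) ρ := by
  refine hf.bdd_mul (c := 1) (Continuous.aestronglyMeasurable (by fun_prop)) 
    (ae_of_all _ fun p => (Circle.norm_coe _).le)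

variable [MeasurableSpace A] [BorelSpace A] [MeasurableSpace (PontryaginDual A)]
  [BorelSpace (PontryaginDual A)] {μ : Measure A} [μ.IsHaarMeasure] [μ.Regular]
  {ν : Measure (PontryaginDual A)} [ν.IsHaarMeasure] [ν.Regular]

theorem integral_radonProd_swap {X Y : Type*} [TopologicalSpace X] [T2Space X]
    [LocallyCompactSpace X] [MeasurableSpace X] [BorelSpace X] [TopologicalSpace Y] [T2Space Y]
    [LocallyCompactSpace Y] [MeasurableSpace Y] [BorelSpace Y] {μ : Measure X} [μ.Regular]
    {ν : Measure Y} [ν.Regular] {f : X × Y → ℂ} (hf : Integrable f (radonProd μ ν)) :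
    Integrable (fun p : Y × X => f (p.2, p.1)) (radonProd ν μ) ∧
      ∫ p : Y × X, f (p.2, p.1) ∂(radonProd ν μ) = ∫ p, f p ∂(radonProd μ ν) := by
  have h := measurePreserving_swap_radonProd ν μ
  have he : MeasurableEmbedding (Prod.swap : Y × X → X × Y) :=
    (Homeomorph.prodComm Y X).measurableEmbedding
  exact ⟨(h.integrable_comp_emb he).2 hf, h.integral_comp he f⟩

theorem continuous_fourierDual {e : A → ℂ} (he : Continuous e) (he' : HasCompactSupport e) :
    Continuous (fourierDual μ e) := by
  refine continuousOn_univ.mp (continuousOn_integral_of_compact_support (μ := μ) he'.isCompact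
    (s := Set.univ) (f := fun (ξ : PontryaginDual A) x => (((ξ x)⁻¹ : Circle) : ℂ) * e x) ?_ ?_)
  · have := (continuous_pontryaginDual_apply (A := A))
    refine Continuous.continuousOn ?_
    change Continuous fun p : PontryaginDual A × A => (((p.1 p.2)⁻¹ : Circle) : ℂ) * e p.2
    fun_prop
  · intro ξ x _ hx
    simp [image_eq_zero_of_notMem_tsupport hx]

theorem integrable_circle_mul_of_hasCompactSupport (ξ : PontryaginDual A) {e : A → ℂ}
    (he : Continuous e) (he' : HasCompactSupport e) :
    Integrable (fun x => (((ξ x)⁻¹ : Circle) : ℂ) * e x) μ :=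
  (he.integrable_of_hasCompactSupport he').circle_mul (u := fun x => (ξ x)⁻¹)
    (by have := map_continuous ξ; fun_prop)

theorem fourierDual_add_const_mul {a b : A → ℂ} (ha : Continuous a) (ha' : HasCompactSupport a)
    (hb : Continuous b) (hb' : HasCompactSupport b) (c : ℂ) (ξ : PontryaginDual A) :
    fourierDual μ (fun x => a x + c * b x) ξ = fourierDual μ a ξ + c * fourierDual μ b ξ := by
  unfold fourierDual
  rw [← integral_const_mul, ← integral_add (integrable_circle_mul_of_hasCompactSupport ξ ha ha')
    ((integrable_circle_mul_of_hasCompactSupport ξ hb hb').const_mul c)]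
  congr 1
  ext x
  ring

theorem IsDualHaarMeasure.eLpNorm_fourierDual (hν : IsDualHaarMeasure μ ν) {e : A → ℂ}
    (he : Continuous e) (he' : HasCompactSupport e) :
    eLpNorm (fourierDual μ e) 2 ν = eLpNorm e 2 μ := by
  have h := hν e he he'
  rw [eLpNorm_eq_lintegral_rpow_enorm_toReal two_ne_zero ENNReal.ofNat_ne_top,
    eLpNorm_eq_lintegral_rpow_enorm_toReal two_ne_zero ENNReal.ofNat_ne_top]
  simp only [ENNReal.toReal_ofNat, ENNReal.rpow_ofNat, h]

theorem IsDualHaarMeasure.memLp_fourierDual (hν : IsDualHaarMeasure μ ν) {e : A → ℂ}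
    (he : Continuous e) (he' : HasCompactSupport e) : MemLp (fourierDual μ e) 2 ν := by
  have h : MemLp e 2 μ := he.memLp_of_hasCompactSupport he'
  exact ⟨(continuous_fourierDual he he').aestronglyMeasurable,
    (hν.eLpNorm_fourierDual he he').trans_lt h.2⟩

/-- Polarization: Plancherel applied to b + c a for c = ±1, ±i determines the inner product. -/
theorem integral_fourierDual_mul_conj (hν : IsDualHaarMeasure μ ν) {a b : A → ℂ}
    (ha : Continuous a) (ha' : HasCompactSupport a) (hb : Continuous b)
    (hb' : HasCompactSupport b) :
    ∫ ξ, fourierDual μ a ξ * (starRingEnd ℂ) (fourierDual μ b ξ) ∂ν =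
      ∫ x, a x * (starRingEnd ℂ) (b x) ∂μ := by
  have hA : MemLp a 2 μ := ha.memLp_of_hasCompactSupport ha'
  have hB : MemLp b 2 μ := hb.memLp_of_hasCompactSupport hb'
  have hFA := hν.memLp_fourierDual ha ha'
  have hFB := hν.memLp_fourierDual hb hb'
  have hn : ∀ c : ℂ, ‖hFB.toLp + c • hFA.toLp‖ = ‖hB.toLp + c • hA.toLp‖ := fun c => by
    rw [← MemLp.toLp_const_smul, ← MemLp.toLp_const_smul, ← MemLp.toLp_add, ← MemLp.toLp_add,
      Lp.norm_toLp, Lp.norm_toLp, ← hν.eLpNorm_fourierDual (hb.add (ha.const_smul c))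
      (hb'.add (ha'.smul_left (f := fun _ => c)))]
    congr 2
    ext ξ
    exact (fourierDual_add_const_mul hb hb' ha ha' c ξ).symm
  have hi : inner ℂ hFB.toLp hFA.toLp = inner ℂ hB.toLp hA.toLp := by
    have h1 := hn 1
    have h2 := hn (-1)
    have h3 := hn Complex.I
    have h4 := hn (-Complex.I)
    simp only [one_smul, neg_smul, ← sub_eq_add_neg] at h1 h2 h3 h4
    rw [inner_eq_sum_norm_sq_div_four, inner_eq_sum_norm_sq_div_four]
    simp only [RCLike.I_to_complex]
    rw [h1, h2, h3, h4]
  rw [L2.inner_def, L2.inner_def] at hi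
  refine Eq.trans (integral_congr_ae ?_) (hi.trans (integral_congr_ae ?_))
  · filter_upwards [hFA.coeFn_toLp, hFB.coeFn_toLp] with ξ h1 h2
    rw [h1, h2, RCLike.inner_apply]
  · filter_upwards [hA.coeFn_toLp, hB.coeFn_toLp] with ξ h1 h2
    rw [h1, h2, RCLike.inner_apply]

end Pontryagin

/-! ### Integrable functions orthogonal to C_c. -/

section Vanishing

variable {X : Type*} [TopologicalSpace X] [T2Space X] [LocallyCompactSpace X]
  [MeasurableSpace X] [BorelSpace X] {μ : Measure X} [μ.Regular]

theorem ae_eq_zero_of_forall_integral_mul_hasCompactSupport {f : X → ℂ} (hf : Integrable f μ)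
    (h : ∀ g : X → ℂ, Continuous g → HasCompactSupport g → ∫ x, f x * g x ∂μ = 0) :
    f =ᵐ[μ] 0 := by
  have key : ∀ ε : ℝ, 0 < ε → ∫ x, ‖f x‖ ∂μ ≤ 3 * ε := by
    intro ε hε
    obtain ⟨k, hk, hkε, hkc, hki⟩ := exists_hasCompactSupport_lintegral_sub_le hf
      (ε := ENNReal.ofReal ε) (by simpa using hε)
    have hkε' : ∫ x, ‖f x - k x‖ ∂μ ≤ ε := by
      rw [integral_norm_eq_lintegral_enorm (f := fun x => f x - k x)
        (hf.sub hki).aestronglyMeasurable]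
      exact ENNReal.toReal_le_of_le_ofReal hε.le hkε
    set V := (μ (tsupport k)).toReal with hV
    -- The test function s is a continuous substitute for the conjugate phase of k. Since k s ≥ ‖k‖
    -- - δ on the support, of measure V, the loss is at most δ V ≤ ε.
    set δ := ε / (V + 1) with hδ
    have hV0 : 0 ≤ V := ENNReal.toReal_nonneg
    have hδ0 : 0 < δ := by positivity
    set s : X → ℂ := fun x => (starRingEnd ℂ) (k x) / ((δ + ‖k x‖ : ℝ) : ℂ) with hs
    have hne : ∀ x, ((δ + ‖k x‖ : ℝ) : ℂ) ≠ 0 := fun x => by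
      exact_mod_cast (by positivity : δ + ‖k x‖ ≠ 0)
    have hsc : Continuous s := by
      refine Continuous.div (by fun_prop) (by fun_prop) hne
    have hss : HasCompactSupport s := HasCompactSupport.intro hk fun x hx => by
      simp [hs, image_eq_zero_of_notMem_tsupport hx]
    have hs1 : ∀ x, ‖s x‖ ≤ 1 := fun x => by
      rw [hs, norm_div, RCLike.norm_conj, Complex.norm_real, Real.norm_of_nonneg (by positivity)]
      exact div_le_one_of_le₀ (by linarith) (by positivity)
    have hks : ∀ x, k x * s x = ((‖k x‖ ^ 2 / (δ + ‖k x‖) : ℝ) : ℂ) := fun x => by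
      rw [hs]
      simp only
      rw [← mul_div_assoc, Complex.mul_conj, Complex.normSq_eq_norm_sq]
      push_cast
      rfl
    have hksi : Integrable (fun x => k x * s x) μ :=
      (hkc.mul hsc).integrable_of_hasCompactSupport hk.mul_right
    have hfs : Integrable (fun x => f x * s x) μ :=
      hf.mul_bdd (c := 1) hsc.aestronglyMeasurable (ae_of_all _ hs1)
    have h1 : ‖∫ x, k x * s x ∂μ‖ ≤ ε := by
      have : ∫ x, k x * s x ∂μ = ∫ x, (k x - f x) * s x ∂μ := by
        simp only [sub_mul]
        rw [integral_sub hksi hfs, h s hsc hss, sub_zero]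
      rw [this]
      refine (norm_integral_le_integral_norm _).trans (le_trans (integral_mono_of_nonneg
        (ae_of_all _ fun x => norm_nonneg _) (hf.sub hki).norm (ae_of_all _ fun x => ?_)) hkε')
      simp only [norm_mul, Pi.sub_apply]
      rw [norm_sub_rev]
      exact mul_le_of_le_one_right (norm_nonneg _) (hs1 x)
    have h2 : ∫ x, ‖k x‖ ∂μ ≤ ‖∫ x, k x * s x ∂μ‖ + δ * V := by
      have hksr : ∫ x, k x * s x ∂μ = ((∫ x, ‖k x‖ ^ 2 / (δ + ‖k x‖) ∂μ : ℝ) : ℂ) := by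
        simp only [hks]
        exact integral_complex_ofReal
      have hri : Integrable (fun x => ‖k x‖ ^ 2 / (δ + ‖k x‖)) μ := by
        refine Continuous.integrable_of_hasCompactSupport ?_ (HasCompactSupport.intro hk fun x hx => ?_)
        · exact Continuous.div (by fun_prop) (by fun_prop) fun x => by positivity
        · simp [image_eq_zero_of_notMem_tsupport hx]
      have hind : Integrable ((tsupport k).indicator fun _ => δ) μ :=
        (integrable_indicator_iff (isClosed_tsupport k).measurableSet).2
          (integrableOn_const hk.isCompact.measure_lt_top.ne)
      rw [hksr, Complex.norm_real]
      refine le_trans ?_ (add_le_add (le_abs_self _) le_rfl)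
      have : δ * V = ∫ x, (tsupport k).indicator (fun _ => δ) x ∂μ := by
        rw [integral_indicator_const _ (isClosed_tsupport k).measurableSet, smul_eq_mul, mul_comm]
        rfl
      rw [this, ← integral_add hri hind]
      refine integral_mono hki.norm (hri.add hind) fun x => ?_
      by_cases hx : x ∈ tsupport k
      · simp only [indicator_of_mem hx]
        have : 0 < δ + ‖k x‖ := by positivity
        rw [← sub_le_iff_le_add, le_div_iff₀ this]
        nlinarith [sq_nonneg δ]
      · simp [image_eq_zero_of_notMem_tsupport hx, indicator_of_notMem hx]
    have h3 : δ * V ≤ ε := by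
      rw [hδ, div_mul_eq_mul_div, div_le_iff₀ (by positivity)]
      nlinarith
    calc ∫ x, ‖f x‖ ∂μ ≤ ∫ x, (‖f x - k x‖ + ‖k x‖) ∂μ :=
          integral_mono hf.norm ((hf.sub hki).norm.add hki.norm) fun x => by
            simpa using norm_add_le (f x - k x) (k x)
      _ = ∫ x, ‖f x - k x‖ ∂μ + ∫ x, ‖k x‖ ∂μ := integral_add (hf.sub hki).norm hki.norm
      _ ≤ 3 * ε := by linarith
  have h0 : ∫ x, ‖f x‖ ∂μ ≤ 0 := le_of_forall_pos_le_add fun ε hε => by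
    have := key (ε / 3) (by positivity)
    linarith
  have h1 := (integral_eq_zero_iff_of_nonneg (fun x => norm_nonneg _) hf.norm).1
    (le_antisymm h0 (integral_nonneg fun x => norm_nonneg _))
  filter_upwards [h1] with x hx
  simpa using hx

end Vanishing

/-! ### Fourier inversion on A. -/

section Inversion

variable {A : Type*} [CommGroup A] [TopologicalSpace A] [IsTopologicalGroup A]
  [LocallyCompactSpace A] [T2Space A] [MeasurableSpace A] [BorelSpace A]
  [MeasurableSpace (PontryaginDual A)] [BorelSpace (PontryaginDual A)]
  {μ : Measure A} [μ.IsHaarMeasure] [μ.Regular]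
  {ν : Measure (PontryaginDual A)} [ν.IsHaarMeasure] [ν.Regular]

/-- The correlation `s ↦ ∫ e(s⁻¹ x) conj(b(x)) dx`. -/
noncomputable def correlation (μ : Measure A) (e b : A → ℂ) (s : A) : ℂ :=
  ∫ x, e (s⁻¹ * x) * (starRingEnd ℂ) (b x) ∂μ

/-- The inverse Fourier transform `x ↦ ∫ σ(x) w(σ) dσ`. -/
noncomputable def fourierInv (ν : Measure (PontryaginDual A)) (w : PontryaginDual A → ℂ) (x : A) :
    ℂ :=
  ∫ σ, (σ x : ℂ) * w σ ∂ν

theorem fourierDual_translate (e : A → ℂ) (s : A) (σ : PontryaginDual A) :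
    fourierDual μ (fun x => e (s⁻¹ * x)) σ = (((σ s)⁻¹ : Circle) : ℂ) * fourierDual μ e σ := by
  unfold fourierDual
  rw [← integral_mul_left_eq_self (fun x => (((σ x)⁻¹ : Circle) : ℂ) * e (s⁻¹ * x)) s,
    ← integral_const_mul]
  congr 1
  ext x
  rw [inv_mul_cancel_left, map_mul, mul_inv, Circle.coe_mul, mul_assoc]

theorem hasCompactSupport_translate {e : A → ℂ} (he' : HasCompactSupport e) (s : A) :
    HasCompactSupport fun x => e (s⁻¹ * x) :=
  he'.comp_homeomorph (Homeomorph.mulLeft s⁻¹)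

theorem correlation_eq_integral (hν : IsDualHaarMeasure μ ν) {e b : A → ℂ}
    (he : Continuous e) (he' : HasCompactSupport e) (hb : Continuous b)
    (hb' : HasCompactSupport b) (s : A) :
    correlation μ e b s = ∫ σ, (((σ s)⁻¹ : Circle) : ℂ) *
      (fourierDual μ e σ * (starRingEnd ℂ) (fourierDual μ b σ)) ∂ν := by
  rw [correlation, ← integral_fourierDual_mul_conj hν (a := fun x => e (s⁻¹ * x)) (by fun_prop)
    (hasCompactSupport_translate he' s) hb hb']
  simp only [fourierDual_translate, mul_assoc]

theorem integrable_fourierDual_mul_conj (hν : IsDualHaarMeasure μ ν) {e b : A → ℂ}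
    (he : Continuous e) (he' : HasCompactSupport e) (hb : Continuous b)
    (hb' : HasCompactSupport b) :
    Integrable (fun σ => fourierDual μ e σ * (starRingEnd ℂ) (fourierDual μ b σ)) ν :=
  (hν.memLp_fourierDual he he').integrable_mul (hν.memLp_fourierDual hb hb').star

section

variable {e b : A → ℂ} (he : Continuous e) (he' : HasCompactSupport e) (hb : Continuous b)
    (hb' : HasCompactSupport b)

include he hb in
theorem continuous_correlation_kernel :
    Continuous fun p : A × A => e (p.1⁻¹ * p.2) * (starRingEnd ℂ) (b p.2) := by
  fun_prop

include he' hb' in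
theorem hasCompactSupport_correlation_kernel :
    HasCompactSupport fun p : A × A => e (p.1⁻¹ * p.2) * (starRingEnd ℂ) (b p.2) := by
  refine HasCompactSupport.intro ((hb'.isCompact.prod he'.isCompact).image
    (by fun_prop : Continuous fun p : A × A => (p.1 * p.2⁻¹, p.1))) fun p hp => ?_
  by_cases h2 : p.2 ∈ tsupport b
  · by_cases h1 : p.1⁻¹ * p.2 ∈ tsupport e
    · exact absurd ⟨(p.2, p.1⁻¹ * p.2), ⟨h2, h1⟩, by ext <;> simp⟩ hp
    · simp [image_eq_zero_of_notMem_tsupport h1]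
  · simp [image_eq_zero_of_notMem_tsupport h2]

include he he' hb hb' in
theorem continuous_correlation : Continuous (correlation μ e b) :=
  continuous_integral_slice μ (continuous_correlation_kernel he hb)
    (hasCompactSupport_correlation_kernel he' hb')

include he' hb' in
theorem hasCompactSupport_correlation : HasCompactSupport (correlation μ e b) :=
  hasCompactSupport_integral_slice μ (hasCompactSupport_correlation_kernel he' hb')

include he he' hb hb' in
theorem integral_mul_correlation (σ : PontryaginDual A) :
    ∫ s, (σ s : ℂ) * correlation μ e b s ∂μ =
      fourierDual μ e σ * (starRingEnd ℂ) (fourierDual μ b σ) := by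
  have hσ := map_continuous σ
  unfold correlation
  simp only [← integral_const_mul]
  rw [integral_integral_swap_of_hasCompactSupport
    (f := fun s x => (σ s : ℂ) * (e (s⁻¹ * x) * (starRingEnd ℂ) (b x)))
    (by simp only [Function.uncurry_def]; fun_prop)
    ((hasCompactSupport_correlation_kernel he' hb').mul_left
      (f := fun p : A × A => (σ p.1 : ℂ)))]
  have h1 : ∀ x, ∫ s, (σ s : ℂ) * (e (s⁻¹ * x) * (starRingEnd ℂ) (b x)) ∂μ =
      fourierDual μ e σ * ((σ x : ℂ) * (starRingEnd ℂ) (b x)) := fun x => by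
    rw [← integral_div_left_eq_self _ μ x, fourierDual, ← integral_mul_const]
    congr 1
    ext t
    rw [show (x / t)⁻¹ * x = t by simp, map_div, div_eq_mul_inv, Circle.coe_mul]
    ring
  simp only [h1]
  rw [integral_const_mul, fourierDual, fourierDual, ← integral_conj]
  congr 2
  ext x
  rw [map_mul, Circle.coe_inv_eq_conj, Complex.conj_conj]

end

theorem integrable_inv_apply_mul {g : A → ℂ} {w : PontryaginDual A → ℂ} (hg : Integrable g μ)
    (hw : Integrable w ν) :
    Integrable (fun p : A × PontryaginDual A => (((p.2 p.1)⁻¹ : Circle) : ℂ) * (g p.1 * w p.2))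
      (radonProd μ ν) :=
  (hg.mul_radonProd hw).circle_mul
    (u := fun p => (p.2 p.1)⁻¹) (continuous_snd.pontryaginDual_apply continuous_fst).inv

theorem integrable_apply_mul {g : A → ℂ} {w : PontryaginDual A → ℂ} (hg : Integrable g μ)
    (hw : Integrable w ν) :
    Integrable (fun p : A × PontryaginDual A => (p.2 p.1 : ℂ) * (g p.1 * w p.2))
      (radonProd μ ν) :=
  (hg.mul_radonProd hw).circle_mul (continuous_snd.pontryaginDual_apply continuous_fst)

theorem integrable_mul_fourierInv {g : A → ℂ} {w : PontryaginDual A → ℂ} (hg : Integrable g μ)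
    (hw : Integrable w ν) : Integrable (fun s => g s * fourierInv ν w s) μ := by
  refine (integrable_apply_mul hg hw).radonProd_fubini.2.1.congr (ae_of_all _ fun s => ?_)
  simp only [fourierInv, ← integral_const_mul]
  congr 1
  ext σ
  ring

theorem integral_mul_fourierInv {g : A → ℂ} {w : PontryaginDual A → ℂ} (hg : Integrable g μ)
    (hw : Integrable w ν) :
    ∫ s, g s * fourierInv ν w s ∂μ = ∫ σ, w σ * ∫ s, (σ s : ℂ) * g s ∂μ ∂ν := by
  have h := integrable_apply_mul hg hw
  have h' := integral_radonProd_swap h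
  rw [h.radonProd_fubini.2.2, h'.1.radonProd_fubini.2.2] at h'
  simp only [fourierInv, ← integral_const_mul]
  refine Eq.trans ?_ (h'.2.symm.trans ?_) <;>
  · congr 1
    ext
    congr 1
    ext
    ring

theorem integral_mul_correlation_eq (hν : IsDualHaarMeasure μ ν) {g e b : A → ℂ}
    (hg : Integrable g μ) (he : Continuous e) (he' : HasCompactSupport e) (hb : Continuous b)
    (hb' : HasCompactSupport b) :
    Integrable (fun s => g s * correlation μ e b s) μ ∧
    ∫ s, g s * correlation μ e b s ∂μ = ∫ σ, fourierDual μ g σ *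
      (fourierDual μ e σ * (starRingEnd ℂ) (fourierDual μ b σ)) ∂ν := by
  have h := integrable_inv_apply_mul hg (integrable_fourierDual_mul_conj hν he he' hb hb')
  have h' := integral_radonProd_swap h
  rw [h.radonProd_fubini.2.2, h'.1.radonProd_fubini.2.2] at h'
  have hc : ∀ s, ∫ σ, (((σ s)⁻¹ : Circle) : ℂ) * (g s * (fourierDual μ e σ *
      (starRingEnd ℂ) (fourierDual μ b σ))) ∂ν = g s * correlation μ e b s := fun s => by
    rw [correlation_eq_integral hν he he' hb hb', ← integral_const_mul]
    congr 1
    ext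
    ring
  simp only [hc] at h'
  refine ⟨by simpa only [hc] using h.radonProd_fubini.2.1, h'.2.symm.trans ?_⟩
  refine integral_congr_ae (ae_of_all _ fun σ => ?_)
  change _ = (∫ x, (((σ x)⁻¹ : Circle) : ℂ) * g x ∂μ) * _
  rw [← integral_mul_const]
  refine integral_congr_ae (ae_of_all _ fun s => ?_)
  ring

/-- Both terms pair with the correlation to ∫ ĝ ê conj(b̂): the first by Parseval for translates of
e, the second because the transform of a correlation is ê conj(b̂), up to σ ↦ σ⁻¹. -/
theorem integral_sub_fourierInv_mul_correlation (hν : IsDualHaarMeasure μ ν) {g e b : A → ℂ}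
    (hg : Integrable g μ) (hg' : Integrable (fourierDual μ g) ν) (he : Continuous e)
    (he' : HasCompactSupport e) (hb : Continuous b) (hb' : HasCompactSupport b) :
    ∫ s, (g s - fourierInv ν (fourierDual μ g) s) * correlation μ e b s ∂μ = 0 := by
  obtain ⟨h1, h2⟩ := integral_mul_correlation_eq hν hg he he' hb hb'
  have hc : Integrable (correlation μ e b) μ :=
    (continuous_correlation he he' hb hb').integrable_of_hasCompactSupport
      (hasCompactSupport_correlation he' hb')
  have h3 := integrable_mul_fourierInv hc hg'
  have h4 := integral_mul_fourierInv hc hg'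
  simp only [integral_mul_correlation he he' hb hb'] at h4
  simp only [sub_mul, mul_comm (fourierInv _ _ _)]
  rw [integral_sub h1 h3, h2, h4, sub_self]

/-- A function orthogonal to all correlations is orthogonal to all of `C_c`. -/
theorem integral_mul_eq_zero_of_correlation {D : A → ℂ}
    (hD : ∀ c : A → ℂ, Continuous c → HasCompactSupport c → Integrable (fun s => D s * c s) μ)
    (h0 : ∀ e b : A → ℂ, Continuous e → HasCompactSupport e → Continuous b → HasCompactSupport b →
      ∫ s, D s * correlation μ e b s ∂μ = 0)
    {h : A → ℂ} (hc : Continuous h) (hs : HasCompactSupport h) : ∫ s, D s * h s ∂μ = 0 := by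
  obtain ⟨V, hV, hV1⟩ := exists_compact_mem_nhds (1 : A)
  -- This compact set carries h and all its averages over translates by elements of V. The cutoff κ,
  -- equal to 1 on it, gives an error bound independent of ε.
  set K' : Set A := (fun p : A × A => p.1 * p.2⁻¹) '' (tsupport h ×ˢ V) with hK'
  have hK'c : IsCompact K' := (hs.isCompact.prod hV).image (by fun_prop)
  have hout : ∀ s ∉ K', ∀ t ∈ V, h (s * t) = 0 := fun s hs t ht => by
    by_contra hne
    exact hs ⟨(s * t, t), ⟨subset_tsupport _ hne, ht⟩, by simp⟩
  obtain ⟨κ, hκ1, hκc, -, hκ01⟩ := exists_continuousMap_one_of_isCompact_subset_isOpen hK'c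
    isOpen_univ (subset_univ _)
  have hκD : Integrable (fun s => D s * (κ s : ℂ)) μ :=
    hD _ (by fun_prop) (HasCompactSupport.comp_left (f := κ) (g := ((↑) : ℝ → ℂ)) hκc
      Complex.ofReal_zero)
  have key : ∀ ε : ℝ, 0 < ε → ‖∫ s, D s * h s ∂μ‖ ≤ ε * ∫ s, ‖D s * (κ s : ℂ)‖ ∂μ := by
    intro ε hε
    have hev : ∀ᶠ t in 𝓝 (1 : A), ∀ s ∈ K', ‖h (s * t) - h s‖ < ε := by
      refine hK'c.eventually_forall_of_forall_eventually fun s _ => ?_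
      have hcont : Continuous fun z : A × A => ‖h (z.2 * z.1) - h z.2‖ := by fun_prop
      exact (hcont.tendsto (1, s)).eventually (gt_mem_nhds (by simpa using hε))
    obtain ⟨W, hWsub, hWo, hW1⟩ := mem_nhds_iff.1 (inter_mem hev hV1)
    obtain ⟨e, he1, hec, heW, he01⟩ := exists_continuousMap_one_of_isCompact_subset_isOpen
      (isCompact_singleton (x := (1 : A))) hWo (singleton_subset_iff.2 hW1)
    have hI : 0 < ∫ t, e t ∂μ := e.continuous.integral_pos_of_hasCompactSupport_nonneg_nonzero
      (x := 1) hec (fun t => (he01 t).1) (by simp [he1 rfl])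
    set I := ∫ t, e t ∂μ
    -- An approximate identity: its correlation with the conjugate of h is s ↦ ∫ E(t) h(st) dt,
    -- uniformly close to h.
    set E : A → ℂ := fun t => ((e t / I : ℝ) : ℂ) with hE
    have hEc : Continuous E := by fun_prop
    have hEs : HasCompactSupport E := HasCompactSupport.intro hec fun t ht => by
      simp [hE, image_eq_zero_of_notMem_tsupport ht]
    have hE1 : ∫ t, E t ∂μ = 1 := by
      rw [hE, integral_complex_ofReal, integral_div, div_self hI.ne', Complex.ofReal_one]
    have hEn : ∫ t, ‖E t‖ ∂μ = 1 := by
      have : ∀ t, ‖E t‖ = e t / I := fun t => by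
        rw [hE, Complex.norm_real, Real.norm_of_nonneg (div_nonneg (he01 t).1 hI.le)]
      simp only [this]
      rw [integral_div, div_self hI.ne']
    have hE0 : ∀ t ∉ W, E t = 0 := fun t ht => by
      have : e t = 0 := by
        by_contra hne
        exact ht (heW (subset_tsupport _ hne))
      simp [hE, this]
    set b : A → ℂ := fun x => (starRingEnd ℂ) (h x) with hb
    have hbc : Continuous b := by fun_prop
    have hbs : HasCompactSupport b := hs.comp_left (g := starRingEnd ℂ) (map_zero _)
    have hcor : ∀ s, correlation μ E b s = ∫ t, E t * h (s * t) ∂μ := fun s => by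
      rw [correlation, ← integral_mul_left_eq_self _ s]
      simp [hb]
    have hEi := hEc.integrable_of_hasCompactSupport (μ := μ) hEs
    have hdiff : ∀ s, ‖h s - correlation μ E b s‖ ≤ ε * ‖(κ s : ℂ)‖ := by
      intro s
      by_cases hsK : s ∈ K'
      · have h1 : correlation μ E b s - h s = ∫ t, E t * (h (s * t) - h s) ∂μ := by
          simp only [mul_sub]
          rw [integral_sub ((by fun_prop : Continuous fun t => E t *
            h (s * t)).integrable_of_hasCompactSupport hEs.mul_right) (hEi.mul_const _),
            integral_mul_const, hE1, one_mul, hcor]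
        rw [norm_sub_rev, h1, hκ1 hsK]
        calc ‖∫ t, E t * (h (s * t) - h s) ∂μ‖ ≤ ∫ t, ‖E t‖ * ε ∂μ := by
              refine norm_integral_le_of_norm_le (hEi.norm.mul_const _) (ae_of_all _ fun t => ?_)
              by_cases ht : t ∈ W
              · rw [norm_mul]
                exact mul_le_mul_of_nonneg_left ((hWsub ht).1 s hsK).le (norm_nonneg _)
              · simp [hE0 t ht]
          _ = ε * ‖((1 : A → ℝ) s : ℂ)‖ := by rw [integral_mul_const, hEn]; simp
      · have h1 : h s = 0 := by simpa using hout s hsK 1 (mem_of_mem_nhds hV1)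
        have h2 : correlation μ E b s = 0 := by
          rw [hcor]
          refine integral_eq_zero_of_ae (ae_of_all _ fun t => ?_)
          by_cases ht : t ∈ W
          · simp [hout s hsK t (hWsub ht).2]
          · simp [hE0 t ht]
        rw [h1, h2, sub_zero, norm_zero]
        positivity
    have h1 : ∫ s, D s * h s ∂μ = ∫ s, D s * (h s - correlation μ E b s) ∂μ := by
      simp only [mul_sub]
      rw [integral_sub (hD h hc hs) (hD _ (continuous_correlation hEc hEs hbc hbs)
        (hasCompactSupport_correlation hEs hbs)), h0 E b hEc hEs hbc hbs, sub_zero]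
    rw [h1, ← integral_const_mul]
    refine norm_integral_le_of_norm_le (hκD.norm.const_mul ε) (ae_of_all _ fun s => ?_)
    rw [norm_mul, norm_mul, mul_left_comm]
    exact mul_le_mul_of_nonneg_left (hdiff s) (norm_nonneg _)
  have hlim : Tendsto (fun ε : ℝ => ε * ∫ s, ‖D s * (κ s : ℂ)‖ ∂μ) (𝓝[>] 0) (𝓝 0) := by
    have : Continuous fun ε : ℝ => ε * ∫ s, ‖D s * (κ s : ℂ)‖ ∂μ := by fun_prop
    simpa using (this.tendsto 0).mono_left nhdsWithin_le_nhds
  exact norm_le_zero_iff.1 (ge_of_tendsto hlim (eventually_mem_nhdsWithin.mono key))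

/-- Fourier inversion for integrable functions with integrable Fourier transform. -/
theorem eq_fourierInv_ae_of_isCompact (hν : IsDualHaarMeasure μ ν) {g : A → ℂ}
    (hg : Integrable g μ) (hg' : Integrable (fourierDual μ g) ν) {K : Set A} (hK : IsCompact K) :
    ∀ᵐ x ∂μ, x ∈ K → g x = fourierInv ν (fourierDual μ g) x := by
  obtain ⟨κ, hκ1, hκc, -, hκ01⟩ := exists_continuousMap_one_of_isCompact_subset_isOpen hK
    isOpen_univ (subset_univ _)
  have hκs : HasCompactSupport fun x => (κ x : ℂ) :=
    HasCompactSupport.comp_left (f := κ) (g := ((↑) : ℝ → ℂ)) hκc Complex.ofReal_zero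
  have hD : ∀ c : A → ℂ, Continuous c → HasCompactSupport c →
      Integrable (fun s => (g s - fourierInv ν (fourierDual μ g) s) * c s) μ := fun c hc hs => by
    obtain ⟨C, hC⟩ := hc.bounded_above_of_compact_support hs
    simp only [sub_mul]
    refine (hg.mul_bdd (c := C) hc.aestronglyMeasurable (ae_of_all _ hC)).sub ?_
    simpa only [mul_comm] using
      integrable_mul_fourierInv (hc.integrable_of_hasCompactSupport hs (μ := μ)) hg'
  -- The inverse transform is bounded but not known to be integrable on A, so the difference is
  -- first multiplied by κ.
  have h0 := ae_eq_zero_of_forall_integral_mul_hasCompactSupport (hD _ (by fun_prop) hκs)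
    fun f hf hfs => by
      simp only [mul_assoc]
      exact integral_mul_eq_zero_of_correlation hD
        (fun e b he he' hb hb' => integral_sub_fourierInv_mul_correlation hν hg hg' he he' hb hb')
        (h := fun x => (κ x : ℂ) * f x) (by fun_prop) hfs.mul_left
  filter_upwards [h0] with x hx hxK
  simpa [hκ1 hxK, sub_eq_zero] using hx

end Inversion

/-! ### Fourier inversion in the first variable on A². -/

section PartialInversion

variable {A : Type*} [CommGroup A] [TopologicalSpace A] [IsTopologicalGroup A]
  [LocallyCompactSpace A] [T2Space A] [MeasurableSpace A] [BorelSpace A]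
  [MeasurableSpace (PontryaginDual A)] [BorelSpace (PontryaginDual A)]
  {μ : Measure A} [μ.IsHaarMeasure] [μ.Regular]
  {ν : Measure (PontryaginDual A)} [ν.IsHaarMeasure] [ν.Regular]

/-- Fubini applied to ‖f‖. Integrability is essential, since null slices alone do not make a set
null here. -/
theorem ae_eq_zero_of_ae_ae_eq_zero {X Y : Type*} [TopologicalSpace X] [T2Space X]
    [LocallyCompactSpace X] [MeasurableSpace X] [BorelSpace X] [TopologicalSpace Y] [T2Space Y]
    [LocallyCompactSpace Y] [MeasurableSpace Y] [BorelSpace Y] {μ : Measure X} [μ.Regular]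
    {ν : Measure Y} [ν.Regular] {f : X × Y → ℂ} (hf : Integrable f (radonProd μ ν))
    (h : ∀ᵐ y ∂ν, ∀ᵐ x ∂μ, f (x, y) = 0) : ∀ᵐ p ∂(radonProd μ ν), f p = 0 := by
  have h1 : Integrable (fun p => ((‖f p‖ : ℝ) : ℂ)) (radonProd μ ν) := hf.norm.ofReal
  have h2 := integral_radonProd_swap h1
  have h3 : ∫ p, ((‖f p‖ : ℝ) : ℂ) ∂(radonProd μ ν) = 0 := by
    rw [← h2.2, h2.1.radonProd_fubini.2.2]
    refine integral_eq_zero_of_ae ?_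
    filter_upwards [h] with y hy
    refine integral_eq_zero_of_ae ?_
    filter_upwards [hy] with x hx
    simp [hx]
  rw [integral_complex_ofReal, Complex.ofReal_eq_zero] at h3
  filter_upwards [(integral_eq_zero_iff_of_nonneg (fun p => norm_nonneg _) hf.norm).1 h3] with p hp
  simpa using hp

/-- The supports of an approximating sequence suffice. This replaces σ-finiteness when inversion is
localized. -/
theorem exists_isCompact_seq_ae_eq_zero {X : Type*} [TopologicalSpace X] [T2Space X]
    [LocallyCompactSpace X] [MeasurableSpace X] [BorelSpace X] {μ : Measure X} [μ.Regular]
    {f : X → ℂ} (hf : Integrable f μ) :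
    ∃ K : ℕ → Set X, (∀ n, IsCompact (K n)) ∧ ∀ᵐ x ∂μ, (∀ n, x ∉ K n) → f x = 0 := by
  obtain ⟨g, -, hgs, -, hlim⟩ := exists_seq_hasCompactSupport_tendsto hf
  refine ⟨fun n => tsupport (g n), hgs, ?_⟩
  filter_upwards [hlim] with x hx hn
  refine tendsto_nhds_unique hx ?_
  simp [image_eq_zero_of_notMem_tsupport (hn _)]

theorem exists_cutoff {X : Type*} [TopologicalSpace X] [T2Space X] [LocallyCompactSpace X]
    {K : Set X} (hK : IsCompact K) :
    ∃ k : X → ℂ, Continuous k ∧ HasCompactSupport k ∧ ∀ x ∈ K, k x = 1 := by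
  obtain ⟨κ, hκ1, hκc, -, -⟩ := exists_continuousMap_one_of_isCompact_subset_isOpen hK
    isOpen_univ (subset_univ _)
  exact ⟨fun x => (κ x : ℂ), by fun_prop, HasCompactSupport.comp_left (f := κ)
    (g := ((↑) : ℝ → ℂ)) hκc Complex.ofReal_zero, fun x hx => by simp [hκ1 hx]⟩

/-- The inverse partial Fourier transform `(x, y) ↦ ∫ σ(x) f(σ, y) dσ`. -/
noncomputable def partialFourierInv (ν : Measure (PontryaginDual A))
    (f : PontryaginDual A × A → ℂ) (p : A × A) : ℂ :=
  fourierInv ν (fun σ => f (σ, p.2)) p.1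

/-- The factor k makes σ(x) k(x) f(σ, y) integrable in all three variables; Fubini in σ then gives
joint measurability and integrability in (x, y). -/
theorem integrable_mul_partialFourierInv {f : PontryaginDual A × A → ℂ}
    (hf : Integrable f (radonProd ν μ)) {k : A → ℂ} (hk : Integrable k μ) :
    Integrable (fun p : A × A => k p.1 * partialFourierInv ν f p) (radonProd μ μ) := by
  have h1 := (hk.mul_radonProd (integral_radonProd_swap hf).1).circle_mul
    (u := fun p : A × (A × PontryaginDual A) => p.2.2 p.1)
    (Continuous.pontryaginDual_apply (by fun_prop) (by fun_prop))
  have h2 := ((measurePreserving_prodAssoc_radonProd μ μ ν).integrable_comp_emb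
    (Homeomorph.prodAssoc A A (PontryaginDual A)).measurableEmbedding).2 h1
  refine h2.radonProd_fubini.2.1.congr (ae_of_all _ fun p => ?_)
  simp only [partialFourierInv, fourierInv, ← integral_const_mul]
  refine integral_congr_ae (ae_of_all _ fun σ => ?_)
  simp only [Function.comp_apply, Homeomorph.prodAssoc, Homeomorph.homeomorph_mk_coe,
    Equiv.prodAssoc_apply]
  ring

theorem ae_eq_partialFourierInv (hν : IsDualHaarMeasure μ ν) {f : A × A → ℂ}
    (hf : Integrable f (radonProd μ μ)) (hf' : Integrable (partialFourier μ f) (radonProd ν μ))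
    {K : Set A} (hK : IsCompact K) :
    ∀ᵐ p ∂(radonProd μ μ), p.1 ∈ K → f p = partialFourierInv ν (partialFourier μ f) p := by
  obtain ⟨k, hkc, hks, hk1⟩ := exists_cutoff hK
  obtain ⟨C, hC⟩ := hkc.bounded_above_of_compact_support hks
  have hi : Integrable (fun p : A × A =>
      k p.1 * (f p - partialFourierInv ν (partialFourier μ f) p)) (radonProd μ μ) := by
    simp only [mul_sub]
    refine (hf.bdd_mul (c := C) (Continuous.aestronglyMeasurable (by fun_prop))
      (ae_of_all _ fun p => hC _)).sub ?_
    exact integrable_mul_partialFourierInv hf' (hkc.integrable_of_hasCompactSupport hks)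
  have h0 := ae_eq_zero_of_ae_ae_eq_zero hi (by
    filter_upwards [(integral_radonProd_swap hf).1.radonProd_fubini.1,
      (integral_radonProd_swap hf').1.radonProd_fubini.1] with y h1 h2
    filter_upwards [eq_fourierInv_ae_of_isCompact hν h1 h2 hks.isCompact] with x hx
    by_cases hxk : x ∈ tsupport k
    · exact mul_eq_zero_of_right _ (sub_eq_zero.2 (hx hxk))
    · exact mul_eq_zero_of_left (image_eq_zero_of_notMem_tsupport hxk) _)
  filter_upwards [h0] with p hp hpK
  simpa [hk1 _ hpK, sub_eq_zero] using hp

/-- The shear (t, z) ↦ (t/z, z) preserves measure, so the exceptional null set pulls back to a null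
set. -/
theorem ae_ae_eq_partialFourierInv (hν : IsDualHaarMeasure μ ν) {f : A × A → ℂ}
    (hf : Integrable f (radonProd μ μ)) (hf' : Integrable (partialFourier μ f) (radonProd ν μ))
    {K : Set A} (hK : IsCompact K) :
    ∀ᵐ t ∂μ, ∀ᵐ z ∂μ, t * z⁻¹ ∈ K →
      f (t * z⁻¹, z) = partialFourierInv ν (partialFourier μ f) (t * z⁻¹, z) := by
  have h := (measurePreserving_shear_left μ (⟨fun z : A => z⁻¹, by fun_prop⟩ : C(A, A))
    μ).quasiMeasurePreserving.ae (ae_eq_partialFourierInv hν hf hf' hK)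
  filter_upwards [ae_ae_of_ae_radonProd μ μ h] with t ht
  filter_upwards [ht] with z hz
  simpa [mul_comm] using hz

theorem ae_mul_right_of_ae {P : A → Prop} (h : ∀ᵐ t ∂μ, P t) (s : A) : ∀ᵐ x ∂μ, P (x * s) :=
  (measurePreserving_mul_right μ s).quasiMeasurePreserving.ae h

theorem ae_mul_inv_of_ae {P : A → Prop} (h : ∀ᵐ t ∂μ, P t) (s : A) : ∀ᵐ x ∂μ, P (s * x⁻¹) := by
  simpa only [div_eq_mul_inv] using
    (Measure.measurePreserving_div_left μ s).quasiMeasurePreserving.ae h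

/-- In the pentagon integrand `φ₂` may be replaced by its Fourier inversion formula. -/
theorem ae_ae_mul_eq_mul_partialFourierInv (hν : IsDualHaarMeasure μ ν) {f g : A × A → ℂ}
    (hf : Integrable f (radonProd μ μ)) (hf' : Integrable (partialFourier μ f) (radonProd ν μ))
    (hg : Integrable g (radonProd μ μ)) (y u v : A) :
    ∀ᵐ x ∂μ, ∀ᵐ z ∂μ, f (x * y * u * v * z⁻¹, z) * g (x * v, y * z⁻¹) =
      partialFourierInv ν (partialFourier μ f) (x * y * u * v * z⁻¹, z) *
        g (x * v, y * z⁻¹) := by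
  obtain ⟨K, hK, hgK⟩ := exists_isCompact_seq_ae_eq_zero hg
  have h1 := ae_mul_right_of_ae (ae_ae_of_ae_radonProd μ μ hgK) v
  -- With t = xyuv one has t/z = (xv)(y/z)u, so (xv, y/z) ∈ K n puts the first argument of f in this
  -- compact image.
  have h2 : ∀ᵐ t ∂μ, ∀ n, ∀ᵐ z ∂μ, t * z⁻¹ ∈ (fun p : A × A => p.1 * p.2 * u) '' K n →
      f (t * z⁻¹, z) = partialFourierInv ν (partialFourier μ f) (t * z⁻¹, z) :=
    ae_all_iff.2 fun n => ae_ae_eq_partialFourierInv hν hf hf' ((hK n).image (by fun_prop))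
  filter_upwards [h1, ae_mul_right_of_ae h2 (y * u * v)] with x hx1 hx2
  filter_upwards [ae_mul_inv_of_ae hx1 y, ae_all_iff.2 hx2] with z hz1 hz2
  by_cases hz : ∀ n, (x * v, y * z⁻¹) ∉ K n
  · simp [hz1 hz]
  · push Not at hz
    obtain ⟨n, hn⟩ := hz
    have hxyz : x * (y * u * v) = x * y * u * v := by simp only [mul_assoc]
    rw [hxyz] at hz2
    rw [hz2 n ⟨_, hn, ?_⟩]
    simp only
    rw [show x * v * (y * z⁻¹) * u = x * y * u * v * z⁻¹ by
      simp only [mul_assoc, mul_comm, mul_left_comm]]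

end PartialInversion

/-! ### The two evaluations of the pentagon integral. -/

section Pentagon

variable {A : Type*} [CommGroup A] [TopologicalSpace A] [IsTopologicalGroup A]
  [LocallyCompactSpace A] [T2Space A] [MeasurableSpace A] [BorelSpace A]
  [MeasurableSpace (PontryaginDual A)] [BorelSpace (PontryaginDual A)]
  {μ : Measure A} [μ.IsHaarMeasure] [μ.Regular]
  {ν : Measure (PontryaginDual A)} [ν.IsHaarMeasure] [ν.Regular]

theorem pontryaginDual_mul_apply (ξ η : PontryaginDual A) (x : A) : (ξ * η) x = ξ x * η x := rfl

theorem pontryaginDual_inv_apply (ξ : PontryaginDual A) (x : A) : ξ⁻¹ x = (ξ x)⁻¹ := rfl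

/-- The kernel `ξ(y) / η(x)` of the Fourier transform on `A²`. -/
noncomputable def betaKernel (ξ η : PontryaginDual A) (p : A × A) : Circle := ξ p.2 / η p.1

theorem Continuous.betaKernel {P : Type*} [TopologicalSpace P] {ξ η : P → PontryaginDual A}
    {p : P → A × A} (hξ : Continuous ξ) (hη : Continuous η) (hp : Continuous p) :
    Continuous fun t => betaKernel (ξ t) (η t) (p t) :=
  (hξ.pontryaginDual_apply hp.snd).div' (hη.pontryaginDual_apply hp.fst)

theorem betaFourier_eq (f : A × A → ℂ) (ξ η : PontryaginDual A) :
    betaFourier μ f (ξ, η) = ∫ p, (betaKernel ξ η p : ℂ) * f p ∂(radonProd μ μ) := rfl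

theorem integrable_betaKernel_mul {f : A × A → ℂ} (hf : Integrable f (radonProd μ μ))
    (ξ η : PontryaginDual A) :
    Integrable (fun p => (betaKernel ξ η p : ℂ) * f p) (radonProd μ μ) :=
  hf.circle_mul (continuous_const.betaKernel continuous_const continuous_id)

theorem betaFourier_eq_integral_integral {f : A × A → ℂ} (hf : Integrable f (radonProd μ μ))
    (ξ η : PontryaginDual A) :
    betaFourier μ f (ξ, η) = ∫ y, ∫ x, (betaKernel ξ η (x, y) : ℂ) * f (x, y) ∂μ ∂μ := by
  have h := integral_radonProd_swap (integrable_betaKernel_mul hf ξ η)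
  rw [betaFourier_eq, ← h.2, h.1.radonProd_fubini.2.2]

theorem betaFourier_eq_integral_partialFourier {f : A × A → ℂ}
    (hf : Integrable f (radonProd μ μ)) (ξ η : PontryaginDual A) :
    betaFourier μ f (ξ, η) = ∫ y, (ξ y : ℂ) * partialFourier μ f (η, y) ∂μ := by
  rw [betaFourier_eq_integral_integral hf]
  refine integral_congr_ae (ae_of_all _ fun y => ?_)
  simp only [partialFourier, fourierDual, ← integral_const_mul]
  refine integral_congr_ae (ae_of_all _ fun x => ?_)
  simp only [betaKernel, div_eq_mul_inv, Circle.coe_mul, mul_assoc]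

/-- The integrand on `(A² × A²) × (Â × A)`, in the coordinates `((a, b), (d, c)), (σ, z)`. -/
noncomputable def pentagonIntegrand (α β γ δ : PontryaginDual A) (f₄ f₀ : A × A → ℂ)
    (w : PontryaginDual A × A → ℂ)
    (P : ((A × A) × (A × A)) × (PontryaginDual A × A)) : ℂ :=
  ((betaKernel (γ * β) (δ * P.2.1⁻¹) P.1.1 : ℂ) * f₄ P.1.1) *
    ((betaKernel (α * δ) (β * P.2.1⁻¹) P.1.2.swap : ℂ) * f₀ P.1.2.swap) *
    (((α * β * γ * δ * P.2.1⁻¹) P.2.2 : ℂ) * w P.2)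

/-- This is why the relation is self-dual: σ remains only as the inversion kernel at the first
argument of φ₂, and the other characters are those of φ̂₁ and φ̂₃. -/
theorem betaKernel_mul_betaKernel (α β γ δ σ : PontryaginDual A) (x y u v z : A) :
    betaKernel (γ * β) (δ * σ⁻¹) (u * y, v * z⁻¹) *
      betaKernel (α * δ) (β * σ⁻¹) (x * v, y * z⁻¹) * (α * β * γ * δ * σ⁻¹) z =
    betaKernel γ δ (u, v) * betaKernel α β (x, y) * σ (x * y * u * v * z⁻¹) := by
  apply Circle.ext
  simp only [betaKernel, pontryaginDual_mul_apply, pontryaginDual_inv_apply, map_mul, map_inv,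
    Circle.coe_mul, Circle.coe_inv, Circle.coe_div]
  have h := fun (ξ : PontryaginDual A) (t : A) => (ξ t).coe_ne_zero
  field_simp [h]

variable {f₄ f₀ : A × A → ℂ} {w : PontryaginDual A × A → ℂ}

theorem integrable_pentagonIntegrand (α β γ δ : PontryaginDual A)
    (h₄ : Integrable f₄ (radonProd μ μ)) (h₀ : Integrable f₀ (radonProd μ μ))
    (hw : Integrable w (radonProd ν μ)) :
    Integrable (pentagonIntegrand α β γ δ f₄ f₀ w)
      (radonProd (radonProd (radonProd μ μ) (radonProd μ μ)) (radonProd ν μ)) := by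
  have h := (h₄.mul_radonProd (integral_radonProd_swap h₀).1).mul_radonProd hw
  have hu : Continuous fun P : ((A × A) × (A × A)) × (PontryaginDual A × A) =>
      betaKernel (γ * β) (δ * P.2.1⁻¹) P.1.1 * betaKernel (α * δ) (β * P.2.1⁻¹) P.1.2.swap *
        (α * β * γ * δ * P.2.1⁻¹) P.2.2 :=
    ((Continuous.betaKernel (by fun_prop) (by fun_prop) (by fun_prop)).mul
      (Continuous.betaKernel (by fun_prop) (by fun_prop) (by fun_prop))).mul
      (Continuous.pontryaginDual_apply (by fun_prop) (by fun_prop))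
  refine (h.circle_mul hu).congr (ae_of_all _ fun P => ?_)
  simp only [pentagonIntegrand, Circle.coe_mul, Prod.swap]
  ring

theorem integral_pentagonIntegrand_slice (α β γ δ : PontryaginDual A)
    (h₄ : Integrable f₄ (radonProd μ μ)) (h₀ : Integrable f₀ (radonProd μ μ))
    (s : PontryaginDual A × A) :
    ∫ P, pentagonIntegrand α β γ δ f₄ f₀ w (P, s) ∂(radonProd (radonProd μ μ) (radonProd μ μ)) =
      betaFourier μ f₄ (γ * β, δ * s.1⁻¹) * betaFourier μ f₀ (α * δ, β * s.1⁻¹) *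
        (((α * β * γ * δ * s.1⁻¹) s.2 : ℂ) * w s) := by
  have hs := integral_radonProd_swap
    (integrable_betaKernel_mul h₀ (α * δ) (β * s.1⁻¹))
  simp only [pentagonIntegrand]
  rw [integral_mul_const]
  congr 1
  rw [betaFourier_eq, betaFourier_eq, ← hs.2]
  exact integral_mul_radonProd (integrable_betaKernel_mul h₄ (γ * β) (δ * s.1⁻¹)) hs.1

/-- For fixed (σ, z) the integral over A² × A² factors into the transforms of f₄ and f₀, and the
z-integral then produces that of f₂. Fubini supplies the absolute convergence over σ. -/
theorem integral_pentagonIntegrand_eq_dual {f₂ : A × A → ℂ} (α β γ δ : PontryaginDual A)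
    (h₄ : Integrable f₄ (radonProd μ μ)) (h₀ : Integrable f₀ (radonProd μ μ))
    (h₂ : Integrable f₂ (radonProd μ μ)) (h₂' : Integrable (partialFourier μ f₂) (radonProd ν μ)) :
    Integrable (fun σ => betaFourier μ f₄ (γ * β, δ * σ⁻¹) *
      betaFourier μ f₂ (α * β * γ * δ * σ⁻¹, σ) * betaFourier μ f₀ (α * δ, β * σ⁻¹)) ν ∧
    ∫ P, pentagonIntegrand α β γ δ f₄ f₀ (partialFourier μ f₂) P
        ∂(radonProd (radonProd (radonProd μ μ) (radonProd μ μ)) (radonProd ν μ)) =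
      ∫ σ, betaFourier μ f₄ (γ * β, δ * σ⁻¹) *
        betaFourier μ f₂ (α * β * γ * δ * σ⁻¹, σ) * betaFourier μ f₀ (α * δ, β * σ⁻¹) ∂ν := by
  have h := integral_radonProd_swap (integrable_pentagonIntegrand α β γ δ h₄ h₀ h₂')
  have hF := h.1.radonProd_fubini
  simp only [integral_pentagonIntegrand_slice α β γ δ h₄ h₀] at hF
  have hG := hF.2.1.radonProd_fubini
  have he : ∀ σ, ∫ z, betaFourier μ f₄ (γ * β, δ * σ⁻¹) * betaFourier μ f₀ (α * δ, β * σ⁻¹) *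
      (((α * β * γ * δ * σ⁻¹) z : ℂ) * partialFourier μ f₂ (σ, z)) ∂μ =
      betaFourier μ f₄ (γ * β, δ * σ⁻¹) *
        betaFourier μ f₂ (α * β * γ * δ * σ⁻¹, σ) * betaFourier μ f₀ (α * δ, β * σ⁻¹) := fun σ => by
    rw [integral_const_mul, betaFourier_eq_integral_partialFourier h₂]
    ring
  simp only [he] at hG
  exact ⟨hG.2.1, by rw [← h.2, hF.2.2, hG.2.2]⟩

/-- The integrand after the change of variables `(x, y, u, v) ↦ (uy, v/z, xv, y/z)`. -/
theorem integral_pentagonIntegrand_eq_integral (α β γ δ : PontryaginDual A)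
    (h₄ : Integrable f₄ (radonProd μ μ)) (h₀ : Integrable f₀ (radonProd μ μ))
    (hw : Integrable w (radonProd ν μ)) {J : (A × A) → A → A → ℂ}
    (hJ : ∀ p y, ∀ᵐ x ∂μ, J p y x = ∫ z, ∫ σ, pentagonIntegrand α β γ δ f₄ f₀ w
      (((p.1 * y, p.2 * z⁻¹), (y * z⁻¹, x * p.2)), (σ, z)) ∂ν ∂μ) :
    ∫ P, pentagonIntegrand α β γ δ f₄ f₀ w P
        ∂(radonProd (radonProd (radonProd μ μ) (radonProd μ μ)) (radonProd ν μ)) =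
      ∫ p, ∫ y, ∫ x, J p y x ∂μ ∂μ ∂(radonProd μ μ) := by
  set m := radonProd μ μ with hm
  set M := radonProd m m with hM
  set κ := radonProd ν μ with hκ
  set Θ := pentagonIntegrand α β γ δ f₄ f₀ w with hΘ
  have hi : Integrable Θ (radonProd M κ) := integrable_pentagonIntegrand α β γ δ h₄ h₀ hw
  -- The substitution is a product of shears on ((u, v), (y, x)): `gA` turns u into uy, `gB` turns x
  -- into xv, and `gC` divides v and y by z.
  set gC : C(PontryaginDual A × A, (A × A) × (A × A)) :=
    ⟨fun s => ((1, s.2⁻¹), (s.2⁻¹, 1)), by fun_prop⟩ with hgC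
  set gA : C(A × A, A × A) := ⟨fun q => (q.1, 1), by fun_prop⟩ with hgA
  set gB : C(A × A, A × A) := ⟨fun p => (1, p.2), by fun_prop⟩ with hgB
  have hC := measurePreserving_shear_left κ gC M
  have hAB : MeasurePreserving (fun Q : (A × A) × (A × A) =>
      (gA Q.2 * Q.1, gB (gA Q.2 * Q.1) * Q.2)) M M :=
    (measurePreserving_shear_right m gB m).comp (measurePreserving_shear_left m gA m)
  have hCi := hC.integrable_comp hi.aestronglyMeasurable |>.2 hi
  have hCe : ∫ P, Θ P ∂(radonProd M κ) =
      ∫ P, Θ (gC P.2 * P.1, P.2) ∂(radonProd M κ) := by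
    conv_lhs => rw [← hC.map_eq]
    exact integral_map hC.aemeasurable (by rw [hC.map_eq]; exact hi.aestronglyMeasurable)
  have hF := hCi.radonProd_fubini
  simp only [Function.comp_apply] at hF
  have hABi : Integrable (fun Q : (A × A) × (A × A) =>
      ∫ s, Θ (gC s * (gA Q.2 * Q.1, gB (gA Q.2 * Q.1) * Q.2), s) ∂κ) (radonProd m m) :=
    hAB.integrable_comp hF.2.1.aestronglyMeasurable |>.2 hF.2.1
  have hABe : ∫ Q, ∫ s, Θ (gC s * Q, s) ∂κ ∂M =
      ∫ Q, ∫ s, Θ (gC s * (gA Q.2 * Q.1, gB (gA Q.2 * Q.1) * Q.2), s) ∂κ ∂M := by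
    conv_lhs => rw [← hAB.map_eq]
    exact integral_map hAB.aemeasurable (by rw [hAB.map_eq]; exact hF.2.1.aestronglyMeasurable)
  have hABs := hAB.quasiMeasurePreserving.ae hF.1
  rw [hCe, hF.2.2, hABe, hM, hABi.radonProd_fubini.2.2]
  refine integral_congr_ae ?_
  filter_upwards [ae_ae_of_ae_radonProd m m hABs, hABi.radonProd_fubini.1] with p hp hpi
  -- Storing the second pair as (y, x) makes x the inner variable, so `hJ` is needed only for almost
  -- every x.
  rw [hpi.radonProd_fubini.2.2]
  refine integral_congr_ae ?_
  filter_upwards [ae_ae_of_ae_radonProd μ μ hp] with y hy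
  refine integral_congr_ae ?_
  filter_upwards [hy, hJ p y] with x hx hJx
  have hsw := integral_radonProd_swap hx
  rw [hJx, ← hsw.2, hsw.1.radonProd_fubini.2.2]
  refine integral_congr_ae (ae_of_all _ fun z => integral_congr_ae (ae_of_all _ fun σ => ?_))
  simp only [hgA, hgB, hgC, ContinuousMap.coe_mk, Prod.mk_mul_mk, one_mul]
  simp [Prod.mul_def, mul_comm]

theorem isBetaPentagonType_betaFourier (hν : IsDualHaarMeasure μ ν) {φ : Fin 5 → A × A → ℂ}
    (hφ : ∀ i, Integrable (φ i) (radonProd μ μ))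
    (hφ₂ : Integrable (partialFourier μ (φ 2)) (radonProd ν μ))
    (h : IsBetaPentagonType μ φ) :
    IsBetaPentagonType ν (fun i => betaFourier μ (φ i)) := by
  intro α β γ δ
  obtain ⟨hi, he⟩ := integral_pentagonIntegrand_eq_dual α β γ δ (hφ 4) (hφ 0) (hφ 2) hφ₂
  refine ⟨hi, ?_⟩
  simp only
  rw [← he, integral_pentagonIntegrand_eq_integral α β γ δ (hφ 4) (hφ 0) hφ₂
    -- The value left by inversion in σ followed by the pentagon relation in z; it separates (u, v)
    -- from (x, y).
    (J := fun p y x => ((betaKernel γ δ p : ℂ) * φ 3 p) *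
      ((betaKernel α β (x, y) : ℂ) * φ 1 (x, y))) ?_]
  · simp only [integral_const_mul]
    rw [integral_mul_const, ← betaFourier_eq_integral_integral (hφ 1), ← betaFourier_eq, mul_comm]
  · rintro ⟨u, v⟩ y
    filter_upwards [ae_ae_mul_eq_mul_partialFourierInv hν (hφ 2) hφ₂ (hφ 0) y u v] with x hx
    have hσ : ∀ z, ∫ σ, pentagonIntegrand α β γ δ (φ 4) (φ 0) (partialFourier μ (φ 2))
        (((u * y, v * z⁻¹), (y * z⁻¹, x * v)), (σ, z)) ∂ν =
        ((betaKernel γ δ (u, v) * betaKernel α β (x, y) : Circle) : ℂ) *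
          (φ 4 (u * y, v * z⁻¹) * (partialFourierInv ν (partialFourier μ (φ 2))
            (x * y * u * v * z⁻¹, z) * φ 0 (x * v, y * z⁻¹))) := fun z => by
      simp only [partialFourierInv, fourierInv, ← integral_const_mul, ← integral_mul_const]
      refine integral_congr_ae (ae_of_all _ fun σ => ?_)
      have hb := congrArg (fun c : Circle => (c : ℂ))
        (betaKernel_mul_betaKernel α β γ δ σ x y u v z)
      simp only [Circle.coe_mul] at hb
      simp only [pentagonIntegrand, Prod.swap, Circle.coe_mul]
      linear_combination (φ 4 (u * y, v * z⁻¹) * φ 0 (x * v, y * z⁻¹) *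
        partialFourier μ (φ 2) (σ, z)) * hb
    simp only [hσ]
    have hz : ∫ z, ((betaKernel γ δ (u, v) * betaKernel α β (x, y) : Circle) : ℂ) *
          (φ 4 (u * y, v * z⁻¹) * (partialFourierInv ν (partialFourier μ (φ 2))
            (x * y * u * v * z⁻¹, z) * φ 0 (x * v, y * z⁻¹))) ∂μ =
        ∫ z, ((betaKernel γ δ (u, v) * betaKernel α β (x, y) : Circle) : ℂ) *
          (φ 4 (u * y, v * z⁻¹) * φ 2 (x * y * u * v * z⁻¹, z) * φ 0 (x * v, y * z⁻¹)) ∂μ := by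
      refine integral_congr_ae ?_
      filter_upwards [hx] with z hz
      rw [← hz, mul_assoc (φ 4 _)]
    rw [hz, integral_const_mul, ← (h x y u v).2, Circle.coe_mul]
    ring

end Pentagon

end BorelProduct

theorem mainTheorem3 {A : Type*} [CommGroup A] [TopologicalSpace A] [IsTopologicalGroup A]
    [LocallyCompactSpace A] [T2Space A] [MeasurableSpace A] [BorelSpace A]
    [MeasurableSpace (PontryaginDual A)] [BorelSpace (PontryaginDual A)]
    (μ : Measure A) [μ.IsHaarMeasure] [μ.Regular]
    (ν : Measure (PontryaginDual A)) [ν.IsHaarMeasure] [ν.Regular]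
    (hν : IsDualHaarMeasure μ ν)
    (φ : Fin 5 → A × A → ℂ)
    (hφ : ∀ i, Integrable (φ i) (radonProd μ μ))
    (hφ₂ : Integrable (partialFourier μ (φ 2)) (radonProd ν μ))
    (h : IsBetaPentagonType μ φ) :
    IsBetaPentagonType ν (fun i => betaFourier μ (φ i)) :=
  isBetaPentagonType_betaFourier hν hφ hφ₂ h
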